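/- Let $\lambda(x)>0$ ($x\ge 0$), $\mu(0)=0$, $\mu(x)>0$ ($x\ge1$) be the birth and death rates of a birth and death chain on $\mathbb N=\{0,1,2,\dots\}$, with symmetrizing measure $\pi(x)=\prod_{i=1}^{x}\lambda(i-1)/\mu(i)$. Assume that $\infty$ is a natural boundary point: $$\sum_{j\ge0}\frac1{\lambda(j)\pi(j)}\sum_{i=0}^{j}\pi(i)=\infty,\qquad \sum_{j\ge0}\frac1{\lambda(j)\pi(j)}\sum_{i\ge j+1}\pi(i)=\infty .$$ Let $\hat\lambda(x)=\mu(x+1)$, $\hat\mu(x)=\lambda(x)$ be the rates of the Siegmund dual chain and $\hat\pi(x)=\prod_{i=1}^{x}\hat\lambda(i-1)/\hat\mu(i)$. Let $Q_0=1$, $-xQ_0=-(\lambda(0)+\mu(0))Q_0+\lambda(0)Q_1$ and $-xQ_m=\mu(m)Q_{m-1}-(\lambda(m)+\mu(m))Q_m+\lambda(m)Q_{m+1}$ for $m\ge1$, and let $\hat Q_m$ be the polynomials defined in the same way from $(\hat\lambda,\hat\mu)$. Assume that there are unique measures $\mathfrak w$ and $\hat{\mathfrak w}$ on $[0,\infty)$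 with finite moments such that $\int Q_iQ_j\,d\mathfrak w=\delta_{ij}/\pi(j)$ and $\int \hat Q_i\hat Q_j\,d\hat{\mathfrak w}=\delta_{ij}/\hat\pi(j)$ for all $i,j$. Write $\langle f,g\rangle_{\mathfrak m}=\int fg\,d\mathfrak m$ and $\lambda_0=\lambda(0)$. Let $W^n=\{(\nu_1,\dots,\nu_n)\in\mathbb N^n:\nu_1<\cdots<\nu_n\}$. For $\nu\in W^{n+1}$ let $W^{n,n+1}(\nu)=\{k\in W^n:\nu_1\le k_1<\nu_2\le k_2<\cdots\le k_n<\nu_{n+1}\}$, and for $\nu\in W^n$ let $W^{n,n}(\nu)=\{k\in W^n:k_1\le\nu_1<k_2\le\nu_2<\cdots<k_n\le\nu_n\}$. For $n\ge1$ and $\nu\in W^n$ put $$h_{n-1,n}(\nu)=(-1)^{\binom n2}\lambda_0^{\binom n2}\left.\frac{\det(Q_{\nu_i}(x_j))_{i,j=1}^n}{\det(x_j^{i-1})_{i,j=1}^n}\right|_{x=0},\qquad h_{n,n}(\nu)=(-1)^{\binom n2}\lambda_0^{\binom n2}\left.\frac{\det(\hat Q_{\nu_i}(x_j))_{i,j=1}^n}{\det(x_j^{i-1})_{i,j=1}^n}\right|_{x=0},$$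 where the quotients are polynomials in $x_1,\dots,x_n$. Define the links $$\Lambda^{h_{n,n}}_{n,n+1}(\nu,k)=\mathbf 1(k\in W^{n,n+1}(\nu))\frac{\prod_{i=1}^n\hat\pi(k_i)\,h_{n,n}(k)}{h_{n,n+1}(\nu)},\qquad \Lambda^{h_{n-1,n}}_{n,n}(\nu,k)=\mathbf 1(k\in W^{n,n}(\nu))\frac{\prod_{i=1}^n\pi(k_i)\,h_{n-1,n}(k)}{h_{n,n}(\nu)},$$ and, for a function $\psi$, the signed measures on $W^n$ $$\mathcal M^\psi_{n-1,n}(\nu)=\frac{(-1)^{\binom n2}}{\lambda_0^{\binom n2}}\det\left(\langle\pi(\nu_i)Q_{\nu_i},(-x)^{n-j}\psi\rangle_{\mathfrak w}\right)_{i,j=1}^n h_{n-1,n}(\nu),$$ $$\mathcal M^\psi_{n,n}(\nu)=\frac{(-1)^{\binom n2}}{\lambda_0^{\binom n2}}\det\left(\langle\hat\pi(\nu_i)\hat Q_{\nu_i},(-x)^{n-j}\psi\rangle_{\hat{\mathfrak w}}\right)_{i,j=1}^n h_{n,n}(\nu).$$ Let $\psi(x)=p(x)e^{-tx}$ with $p$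 a real polynomial and $t\ge0$. Then for every $n\ge1$ and $k\in W^n$, the following series being (unconditionally) convergent, $$\mathcal M^\psi_{n,n}(k)=\sum_{\nu\in W^{n+1}}\mathcal M^\psi_{n,n+1}(\nu)\,\Lambda^{h_{n,n}}_{n,n+1}(\nu,k)\quad\text{if }\psi(0)=1,$$ $$\mathcal M^\psi_{n-1,n}(k)=\sum_{\nu\in W^{n}}\mathcal M^\psi_{n,n}(\nu)\,\Lambda^{h_{n-1,n}}_{n,n}(\nu,k).$$ -/

import Mathlib

open MeasureTheory Polynomial
open scoped ENNReal

noncomputable section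

namespace BirthDeath

/-- Birth rates of the Siegmund dual chain. -/
def dualBirth (mu : ℕ → ℝ) : ℕ → ℝ := fun x => mu (x + 1)

/-- Death rates of the Siegmund dual chain (from `0` it is killed at rate `lam 0`). -/
def dualDeath (lam : ℕ → ℝ) : ℕ → ℝ := fun x => lam x

/-- The symmetrizing measure of the chain with birth rates `lam` and death rates `mu`,
`π(x) = ∏_{i=1}^{x} lam(i-1) / mu(i)`. -/
def symm (lam mu : ℕ → ℝ) (x : ℕ) : ℝ := ∏ i ∈ Finset.range x, lam i / mu (i + 1)

/-- The boundary point `∞` is natural for the chain with rates `lam, mu`. The two series have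
positive terms, possibly infinite, and are computed in `[0, ∞]`. -/
def NaturalAtInfinity (lam mu : ℕ → ℝ) : Prop :=
  (∑' j : ℕ, ENNReal.ofReal (1 / (lam j * symm lam mu j)) *
      ∑ i ∈ Finset.range (j + 1), ENNReal.ofReal (symm lam mu i)) = ∞ ∧
  (∑' j : ℕ, ENNReal.ofReal (1 / (lam j * symm lam mu j)) *
      ∑' i : ℕ, ENNReal.ofReal (symm lam mu (j + 1 + i))) = ∞

/-- The polynomials of the chain: `Q₀ = 1` and
`-x Qₙ = mu(n) Qₙ₋₁ - (lam(n) + mu(n)) Qₙ + lam(n) Qₙ₊₁`, without the term `Qₙ₋₁` for `n = 0`. -/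
def orthoPoly (lam mu : ℕ → ℝ) : ℕ → ℝ[X]
  | 0 => 1
  | 1 => C (lam 0)⁻¹ * (C (lam 0 + mu 0) - X)
  | n + 2 => C (lam (n + 1))⁻¹ *
      ((C (lam (n + 1) + mu (n + 1)) - X) * orthoPoly lam mu (n + 1)
        - C (mu (n + 1)) * orthoPoly lam mu n)

/-- `w` is a measure on `[0, ∞)` with finite moments, for which the polynomials of the chain
with rates `lam, mu` satisfy `∫ Qᵢ Qⱼ dw = δᵢⱼ / π(j)`. -/
structure IsSpectralMeasure (lam mu : ℕ → ℝ) (w : Measure ℝ) : Prop where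
  support : w (Set.Iio 0) = 0
  moments : ∀ m : ℕ, Integrable (fun x : ℝ => x ^ m) w
  orthogonal : ∀ i j : ℕ,
    ∫ x, (orthoPoly lam mu i).eval x * (orthoPoly lam mu j).eval x ∂w =
      if i = j then 1 / symm lam mu j else 0

/-- The moment problem of the chain with rates `lam, mu` is determinate. -/
def Determinate (lam mu : ℕ → ℝ) : Prop := ∃! w : Measure ℝ, IsSpectralMeasure lam mu w

/-- The discrete chamber `Wⁿ = {ν₁ < ν₂ < ⋯ < νₙ}` in `ℕⁿ`. -/
abbrev Chamber (n : ℕ) : Type := {ν : Fin n → ℕ // StrictMono ν}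

/-- `k ∈ W^{n,n+1}(ν)`: `ν₁ ≤ k₁ < ν₂ ≤ k₂ < ⋯ ≤ kₙ < νₙ₊₁`. -/
def InterlaceSucc {n : ℕ} (ν : Chamber (n + 1)) (k : Chamber n) : Prop :=
  ∀ i : Fin n, ν.1 i.castSucc ≤ k.1 i ∧ k.1 i < ν.1 i.succ

/-- `k ∈ W^{n,n}(ν)`: `k₁ ≤ ν₁ < k₂ ≤ ν₂ < ⋯ < kₙ ≤ νₙ`. -/
def InterlaceSame {n : ℕ} (ν k : Chamber n) : Prop :=
  (∀ i : Fin n, k.1 i ≤ ν.1 i) ∧ ∀ i j : Fin n, (i : ℕ) + 1 = (j : ℕ) → ν.1 i < k.1 j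

/-- The Vandermonde determinant `det (x_j^{i-1})` as a polynomial in `x₁, …, xₙ`. -/
def vdm (n : ℕ) : MvPolynomial (Fin n) ℝ :=
  (Matrix.of fun i j : Fin n => (MvPolynomial.X j : MvPolynomial (Fin n) ℝ) ^ (i : ℕ)).det

/-- The determinant `det (q_{ν_i}(x_j))` as a polynomial in `x₁, …, xₙ`. -/
def polyDet {n : ℕ} (q : ℕ → ℝ[X]) (ν : Fin n → ℕ) : MvPolynomial (Fin n) ℝ :=
  (Matrix.of fun i j : Fin n =>
    Polynomial.aeval (MvPolynomial.X j : MvPolynomial (Fin n) ℝ) (q (ν i))).det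

theorem vdm_dvd_polyDet {n : ℕ} (q : ℕ → ℝ[X]) (ν : Fin n → ℕ) : vdm n ∣ polyDet q ν := by
  classical
  let S := MvPolynomial (Fin n) ℝ
  let g : S[X] := ∏ j : Fin n, (X - C (MvPolynomial.X j))
  have hg : g.Monic := monic_prod_of_monic _ _ fun j _ => monic_X_sub_C _
  have hgd : g.natDegree = n := by
    simp only [g]
    rw [natDegree_prod_of_monic _ _ fun j _ => monic_X_sub_C _]
    simp
  let r : Fin n → S[X] := fun i => ((q (ν i)).map (algebraMap ℝ S)) %ₘ g
  have hroot : ∀ j : Fin n, g.eval (MvPolynomial.X j) = 0 := by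
    intro j
    simp only [g]
    rw [eval_prod]
    exact Finset.prod_eq_zero (Finset.mem_univ j) (by simp)
  have hr : ∀ i j : Fin n, (r i).eval (MvPolynomial.X j) =
      Polynomial.aeval (MvPolynomial.X j : S) (q (ν i)) := by
    intro i j
    have h := congrArg (Polynomial.eval (MvPolynomial.X j : S))
      (modByMonic_add_div ((q (ν i)).map (algebraMap ℝ S)) g)
    rw [eval_add, eval_mul, hroot, zero_mul, add_zero, eval_map_algebraMap] at h
    exact h
  have hdeg : ∀ i : Fin n, (r i).degree < (n : WithBot ℕ) := by
    intro i
    have h := degree_modByMonic_lt ((q (ν i)).map (algebraMap ℝ S)) hg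
    rwa [degree_eq_natDegree hg.ne_zero, hgd] at h
  have hmat : (Matrix.of fun i j : Fin n =>
      Polynomial.aeval (MvPolynomial.X j : S) (q (ν i))) =
      (Matrix.of fun i l : Fin n => (r i).coeff l) *
        (Matrix.of fun l j : Fin n => (MvPolynomial.X j : S) ^ (l : ℕ)) := by
    ext1 i j
    rw [Matrix.mul_apply, Matrix.of_apply, ← hr i j]
    rcases Nat.eq_zero_or_pos n with h0 | h0
    · subst h0
      exact i.elim0
    · rw [eval_eq_sum_range' (n := n) (by
        by_cases hz : r i = 0
        · simpa [hz] using h0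
        · exact (natDegree_lt_iff_degree_lt hz).2 (hdeg i))]
      rw [← Fin.sum_univ_eq_sum_range
        (fun l => (r i).coeff l * (MvPolynomial.X j : S) ^ l) n]
      rfl
  unfold polyDet vdm
  rw [hmat, Matrix.det_mul]
  exact Dvd.intro_left _ rfl

/-- The multivariate Karlin–McGregor polynomial `det (q_{ν_i}(x_j)) / det (x_j^{i-1})`, a
polynomial in `x₁, …, xₙ`. -/
def multiPoly {n : ℕ} (q : ℕ → ℝ[X]) (ν : Fin n → ℕ) : MvPolynomial (Fin n) ℝ :=
  Classical.choose (vdm_dvd_polyDet q ν)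

theorem vdm_mul_multiPoly {n : ℕ} (q : ℕ → ℝ[X]) (ν : Fin n → ℕ) :
    vdm n * multiPoly q ν = polyDet q ν :=
  (Classical.choose_spec (vdm_dvd_polyDet q ν)).symm

/-- The harmonic function `h_{n-1,n}` on `Wⁿ`, that is
`(-1)^{n(n-1)/2} λ₀^{n(n-1)/2}` times the value at `x = 0` of the multivariate polynomial. -/
def harmOdd (lam mu : ℕ → ℝ) {n : ℕ} (ν : Chamber n) : ℝ :=
  (-1) ^ n.choose 2 * lam 0 ^ n.choose 2 *
    MvPolynomial.eval 0 (multiPoly (orthoPoly lam mu) ν.1)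

/-- The harmonic function `h_{n,n}` on `Wⁿ`, built from the dual polynomials. -/
def harmEven (lam mu : ℕ → ℝ) {n : ℕ} (ν : Chamber n) : ℝ :=
  (-1) ^ n.choose 2 * lam 0 ^ n.choose 2 *
    MvPolynomial.eval 0 (multiPoly (orthoPoly (dualBirth mu) (dualDeath lam)) ν.1)

/-- The link `Λ_{n,n+1}^{h_{n,n}}(ν, k)` from `W^{n+1}` to `Wⁿ`. -/
def linkSucc (lam mu : ℕ → ℝ) {n : ℕ} (ν : Chamber (n + 1)) (k : Chamber n) : ℝ :=
  open scoped Classical in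
  if InterlaceSucc ν k then
    (∏ i, symm (dualBirth mu) (dualDeath lam) (k.1 i)) * harmEven lam mu k / harmOdd lam mu ν
  else 0

/-- The link `Λ_{n,n}^{h_{n-1,n}}(ν, k)` from `Wⁿ` to `Wⁿ`. -/
def linkSame (lam mu : ℕ → ℝ) {n : ℕ} (ν k : Chamber n) : ℝ :=
  open scoped Classical in
  if InterlaceSame ν k then
    (∏ i, symm lam mu (k.1 i)) * harmOdd lam mu k / harmEven lam mu ν
  else 0

/-- The weights of the signed measure `M^ψ_{n-1,n}` on `Wⁿ`. With `i, j` counted from `0`, the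
exponent `n - j` of `-x` reads `n - 1 - j`. -/
def cohOdd (lam mu : ℕ → ℝ) (w : Measure ℝ) (ψ : ℝ → ℝ) {n : ℕ} (ν : Chamber n) : ℝ :=
  (-1) ^ n.choose 2 / lam 0 ^ n.choose 2 *
    (Matrix.of fun i j : Fin n =>
      ∫ x, symm lam mu (ν.1 i) * (orthoPoly lam mu (ν.1 i)).eval x *
        ((-x) ^ (n - 1 - (j : ℕ)) * ψ x) ∂w).det *
    harmOdd lam mu ν

/-- The weights of the signed measure `M^ψ_{n,n}` on `Wⁿ`; here `w'` stands for the spectral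
measure of the dual chain. -/
def cohEven (lam mu : ℕ → ℝ) (w' : Measure ℝ) (ψ : ℝ → ℝ) {n : ℕ} (ν : Chamber n) : ℝ :=
  (-1) ^ n.choose 2 / lam 0 ^ n.choose 2 *
    (Matrix.of fun i j : Fin n =>
      ∫ x, symm (dualBirth mu) (dualDeath lam) (ν.1 i) *
        (orthoPoly (dualBirth mu) (dualDeath lam) (ν.1 i)).eval x *
        ((-x) ^ (n - 1 - (j : ℕ)) * ψ x) ∂w').det *
    harmEven lam mu ν

end BirthDeath

end

noncomputable section

namespace BirthDeath

open Filter Topology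

/-! Each measure contains as a factor the harmonic function by which its link divides. Once these
functions are known to be nonzero, each identity sums determinants over an interlacing set. For
fixed `k` that set is a product of intervals contained in the chamber, so by multilinearity the sum
is the determinant of the row sums, and row operations turn sums over consecutive intervals into
initial or final sums (`hasSum_interlaceSucc`, `hasSum_interlaceSame`).

The one-dimensional sums come from Siegmund duality: Q̂_y = ∑_{m ≤ y} π(m) Q_m and λ₀(Q_{m+1} - Q_m)
= -x π̂(m) Q̂_m. With determinacy of the dual moment problem these give dŵ = (x/λ₀) dw. Partial sums
are then explicit, and two limits remain for ψ = p e^{-tx}: ∫ Q_m ψ dw → 0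
(`tendsto_integral_exp_zero`, Feller property) and ∫ Q̂_y ψ dw → ψ(0) (`tendsto_integral_dual_exp`,
no explosion). The first yields ∑_{l ≥ m} π̂(l) ∫ Q̂_l ψ dŵ = ∫ Q_m ψ dw, the second ∑ π(m) ∫ Q_m ψ
dw = ψ(0). If ψ(0) = 1, the powers of -x make the last row of the determinant of size n+1 equal to
(0,…,0,1), which lowers the size to n.

Both limits follow from naturality through resolvents. For bounded f, the function m ↦ ∫ Q_m Q_j f
dw is square summable by Bessel, and multiplication by x inside the integral acts as minus the
generator. A comparison principle for square summable functions then shows that multiplying f by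
1/(1+ax) preserves positivity. Powers (1+tx/N)^{-N} carry this to e^{-tx} and bound it by the
resolvent 1/(1+x), which vanishes at infinity. Positivity also gives unconditional convergence,
first for p in the orthogonal basis and then by linearity.

The harmonic functions are positive because their values are determinants of lowest coefficients,
which duality writes as sums of the determinants one level below. -/

/-- The rates of a birth and death chain on `ℕ`, possibly killed at `0`. -/
structure IsRates (lam mu : ℕ → ℝ) : Prop where
  birth_pos : ∀ x, 0 < lam x
  kill_nonneg : 0 ≤ mu 0
  death_pos : ∀ x, 0 < mu (x + 1)

/-- The series `∑ⱼ 1 / (λ(j) π(j)) ∑_{i > j} π(i)` diverges, as does each of its tails. -/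
def NotEntrance (lam mu : ℕ → ℝ) : Prop :=
  ∀ (i : ℕ) (B : ℝ), ∃ M, B < ∑ l ∈ Finset.Ioc i M,
    symm lam mu l * ∑ j ∈ Finset.Ico i l, 1 / (lam j * symm lam mu j)

/-! ### Difference equations for the generator and the comparison principle -/

section Sequences

variable {lam mu : ℕ → ℝ}

theorem symm_pos (hr : IsRates lam mu) (x : ℕ) : 0 < symm lam mu x :=
  Finset.prod_pos fun i _ => div_pos (hr.birth_pos i) (hr.death_pos i)

theorem symm_zero : symm lam mu 0 = 1 := by simp [symm]

theorem symm_succ_mul (hr : IsRates lam mu) (x : ℕ) :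
    symm lam mu (x + 1) * mu (x + 1) = lam x * symm lam mu x := by
  have := (hr.death_pos x).ne'
  simp only [symm, Finset.prod_range_succ]
  field_simp

theorem conductance_pos (hr : IsRates lam mu) (x : ℕ) : 0 < lam x * symm lam mu x :=
  mul_pos (hr.birth_pos x) (symm_pos hr x)

/-- The flux of `v` across the edge from `m` to `m + 1`. -/
def flux (lam mu : ℕ → ℝ) (v : ℕ → ℝ) (m : ℕ) : ℝ :=
  lam m * symm lam mu m * (v (m + 1) - v m)

/-- The generator of the chain. -/
def gen (lam mu : ℕ → ℝ) (v : ℕ → ℝ) : ℕ → ℝ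
  | 0 => lam 0 * (v 1 - v 0) - mu 0 * v 0
  | m + 1 => lam (m + 1) * (v (m + 2) - v (m + 1)) - mu (m + 1) * (v (m + 1) - v m)

theorem flux_zero (v : ℕ → ℝ) : flux lam mu v 0 = gen lam mu v 0 + mu 0 * v 0 := by
  simp [flux, gen, symm_zero]

theorem flux_succ (hr : IsRates lam mu) (v : ℕ → ℝ) (m : ℕ) :
    flux lam mu v (m + 1) = flux lam mu v m + symm lam mu (m + 1) * gen lam mu v (m + 1) := by
  simp only [flux, gen, ← symm_succ_mul hr m]
  ring

theorem sub_eq_flux_div (hr : IsRates lam mu) (v : ℕ → ℝ) (m : ℕ) :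
    v (m + 1) - v m = flux lam mu v m * (1 / (lam m * symm lam mu m)) := by
  have := (conductance_pos hr m).ne'
  unfold flux
  rw [mul_one_div, mul_div_cancel_left₀ _ this]

theorem sub_eq_sum_flux (hr : IsRates lam mu) (v : ℕ → ℝ) {i m : ℕ} (h : i ≤ m) :
    v m - v i = ∑ j ∈ Finset.Ico i m, flux lam mu v j * (1 / (lam j * symm lam mu j)) := by
  induction m, h using Nat.le_induction with
  | base => simp
  | succ m hm ih => rw [Finset.sum_Ico_succ_top hm, ← ih, ← sub_eq_flux_div hr]; ring

/-- A function whose flux is once positive and does not decrease is not square summable. -/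
theorem not_summable_of_flux_pos (hr : IsRates lam mu) (hE : NotEntrance lam mu)
    {v : ℕ → ℝ} {i : ℕ} (hv : 0 ≤ v i) (hf : 0 < flux lam mu v i)
    (hstep : ∀ m, i ≤ m → 0 ≤ v (m + 1) → flux lam mu v m ≤ flux lam mu v (m + 1)) :
    ¬ Summable fun m => symm lam mu m * v m ^ 2 := by
  intro hs
  set c := flux lam mu v i with hc
  have key : ∀ m, i ≤ m → c ≤ flux lam mu v m ∧ 0 ≤ v m := by
    intro m hm
    induction m, hm using Nat.le_induction with
    | base => exact ⟨le_rfl, hv⟩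
    | succ m hm ih =>
      have h1 : 0 ≤ v (m + 1) := by
        have := sub_eq_flux_div hr v m
        have h2 : 0 ≤ flux lam mu v m * (1 / (lam m * symm lam mu m)) :=
          mul_nonneg (hf.le.trans ih.1) (one_div_nonneg.2 (conductance_pos hr m).le)
        linarith [ih.2]
      exact ⟨ih.1.trans (hstep m hm h1), h1⟩
  have hlow : ∀ m, i ≤ m → c * ∑ j ∈ Finset.Ico i m, 1 / (lam j * symm lam mu j) ≤ v m := by
    intro m hm
    have h1 := sub_eq_sum_flux hr v hm
    have h2 : c * ∑ j ∈ Finset.Ico i m, 1 / (lam j * symm lam mu j) ≤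
        ∑ j ∈ Finset.Ico i m, flux lam mu v j * (1 / (lam j * symm lam mu j)) := by
      rw [Finset.mul_sum]
      refine Finset.sum_le_sum fun j hj => ?_
      exact mul_le_mul_of_nonneg_right (key j (Finset.mem_Ico.1 hj).1).1
        (one_div_nonneg.2 (conductance_pos hr j).le)
    linarith
  -- The first increment `d` bounds `v` from below beyond `i`. Hence `v l ^ 2` is at least `d` times
  -- the linear lower bound `hlow`, which produces exactly the divergent sum of `NotEntrance`.
  set d := c * (1 / (lam i * symm lam mu i)) with hd
  have hdpos : 0 < d := mul_pos hf (one_div_pos.2 (conductance_pos hr i))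
  have hlow' : ∀ m, i < m → d ≤ v m := by
    intro m hm
    refine le_trans ?_ (hlow m hm.le)
    refine mul_le_mul_of_nonneg_left ?_ hf.le
    exact Finset.single_le_sum (f := fun j => 1 / (lam j * symm lam mu j))
      (fun j _ => one_div_nonneg.2 (conductance_pos hr j).le)
      (Finset.mem_Ico.2 ⟨le_rfl, hm⟩)
  obtain ⟨M, hM⟩ := hE i ((∑' m, symm lam mu m * v m ^ 2) / (d * c))
  rw [div_lt_iff₀ (mul_pos hdpos hf)] at hM
  have hle : (∑ l ∈ Finset.Ioc i M, symm lam mu l *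
      ∑ j ∈ Finset.Ico i l, 1 / (lam j * symm lam mu j)) * (d * c) ≤
      ∑ l ∈ Finset.Ioc i M, symm lam mu l * v l ^ 2 := by
    rw [Finset.sum_mul]
    refine Finset.sum_le_sum fun l hl => ?_
    have hl' := (Finset.mem_Ioc.1 hl).1
    have h1 := hlow l hl'.le
    have h2 := hlow' l hl'
    have h3 := symm_pos hr l
    calc _ = symm lam mu l * ((c * ∑ j ∈ Finset.Ico i l, 1 / (lam j * symm lam mu j)) * d) := by
          ring
      _ ≤ symm lam mu l * (v l * v l) := by
          refine mul_le_mul_of_nonneg_left ?_ h3.le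
          exact mul_le_mul h1 h2 hdpos.le (hdpos.le.trans h2)
      _ = _ := by ring
  have := hs.sum_le_tsum (Finset.Ioc i M)
    fun m _ => mul_nonneg (symm_pos hr m).le (sq_nonneg (v m))
  linarith

/-- Comparison principle: a square summable subsolution of `v - a L v = 0` is nonpositive. -/
theorem nonpos_of_subsolution (hr : IsRates lam mu) (hE : NotEntrance lam mu) {a : ℝ}
    (ha : 0 < a) {v : ℕ → ℝ} (hv : ∀ m, v m ≤ a * gen lam mu v m)
    (hs : Summable fun m => symm lam mu m * v m ^ 2) (m : ℕ) : v m ≤ 0 := by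
  by_contra hneg
  push Not at hneg
  have hex : ∃ m, 0 < v m := ⟨m, hneg⟩
  classical
  set i := Nat.find hex with hi
  have hvi : 0 < v i := Nat.find_spec hex
  have hgen : ∀ l, 0 < v l → 0 < gen lam mu v l := fun l hl =>
    pos_of_mul_pos_right (hl.trans_le (hv l)) ha.le
  have hgen' : ∀ l, 0 ≤ v l → 0 ≤ gen lam mu v l := fun l hl =>
    nonneg_of_mul_nonneg_right (hl.trans (hv l)) ha
  -- At the first positive index the flux from the left is nonnegative (at `0`, the killing term
  -- is), and the generator is positive wherever `v` is; so the outgoing flux is positive and never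
  -- decreases afterwards.
  refine not_summable_of_flux_pos hr hE hvi.le (i := i) ?_ (fun l _ hl => ?_) hs
  · rcases Nat.eq_zero_or_pos i with h0 | h0
    · rw [h0, flux_zero]
      rw [h0] at hvi
      have := mul_nonneg hr.kill_nonneg hvi.le
      linarith [hgen _ hvi]
    · obtain ⟨l, hl⟩ : ∃ l, i = l + 1 := ⟨i - 1, by omega⟩
      have hvl : v l ≤ 0 := not_lt.1 (Nat.find_min hex (show l < Nat.find hex by omega))
      rw [hl] at hvi ⊢
      rw [flux_succ hr]
      have h1 : 0 ≤ flux lam mu v l :=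
        mul_nonneg (conductance_pos hr l).le (by linarith)
      have h2 := mul_pos (symm_pos hr (l + 1)) (hgen _ hvi)
      linarith
  · rw [flux_succ hr]
    have := mul_nonneg (symm_pos hr (l + 1)).le (hgen' _ hl)
    linarith

theorem sum_Ioc_mul_sum_Ico (f g : ℕ → ℝ) (i M : ℕ) :
    ∑ l ∈ Finset.Ioc i M, f l * ∑ j ∈ Finset.Ico i l, g j =
      ∑ j ∈ Finset.Ico i M, g j * ∑ l ∈ Finset.Ioc j M, f l := by
  simp only [Finset.mul_sum]
  rw [Finset.sum_comm' (t' := Finset.Ico i M) (s' := fun j => Finset.Ioc j M)]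
  · simp only [mul_comm]
  · intro x y
    simp only [Finset.mem_Ioc, Finset.mem_Ico]
    omega

/-- A nonnegative square summable function with `L u = u` far out vanishes at infinity. -/
theorem tendsto_zero_of_gen_eq (hr : IsRates lam mu) (hE : NotEntrance lam mu) {u : ℕ → ℝ}
    (hu : ∀ m, 0 ≤ u m) {i : ℕ} (hgen : ∀ m, i ≤ m → gen lam mu u (m + 1) = u (m + 1))
    (hs : Summable fun m => symm lam mu m * u m ^ 2) : Tendsto u atTop (𝓝 0) := by
  have hmono : ∀ m, i ≤ m → flux lam mu u m ≤ flux lam mu u (m + 1) := by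
    intro m hm
    rw [flux_succ hr, hgen m hm]
    have := mul_nonneg (symm_pos hr (m + 1)).le (hu (m + 1))
    linarith
  have hneg : ∀ m, i ≤ m → flux lam mu u m ≤ 0 := by
    intro m hm
    by_contra h
    push Not at h
    exact not_summable_of_flux_pos hr hE (hu m) h
      (fun l hl _ => hmono l (hm.trans hl)) hs
  have hanti : ∀ m l, i ≤ m → m ≤ l → u l ≤ u m := by
    intro m l hm hl
    have h1 := sub_eq_sum_flux hr u hl
    have h2 : ∑ j ∈ Finset.Ico m l, flux lam mu u j * (1 / (lam j * symm lam mu j)) ≤ 0 :=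
      Finset.sum_nonpos fun j hj => mul_nonpos_of_nonpos_of_nonneg
        (hneg j (hm.trans (Finset.mem_Ico.1 hj).1)) (one_div_nonneg.2 (conductance_pos hr j).le)
    linarith
  rw [Metric.tendsto_atTop]
  intro ε hε
  suffices h : ∃ m, i ≤ m ∧ u m < ε by
    obtain ⟨m, hm, hlt⟩ := h
    refine ⟨m, fun l hl => ?_⟩
    rw [Real.dist_eq, sub_zero, abs_of_nonneg (hu l)]
    exact (hanti m l hm hl).trans_lt hlt
  by_contra hcon
  push Not at hcon
  -- If `u` stays above `ε`, each flux at `j` is at most `-ε` times the mass of `(j, M]`. The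
  -- threshold `u i / ε` then makes the total drop between `i` and `M` exceed `u i`, so `u M` would
  -- be negative.
  obtain ⟨M, hM⟩ := hE i (u i / ε)
  rw [div_lt_iff₀ hε, sum_Ioc_mul_sum_Ico] at hM
  have hiM : i ≤ M := by
    by_contra h
    rw [Finset.Ico_eq_empty (by omega)] at hM
    simp only [Finset.sum_empty, zero_mul] at hM
    linarith [hu i]
  have hflux : ∀ m l, i ≤ m → m ≤ l →
      flux lam mu u m + ε * ∑ x ∈ Finset.Ioc m l, symm lam mu x ≤ flux lam mu u l := by
    intro m l hm hl
    induction l, hl using Nat.le_induction with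
    | base => simp
    | succ l hl ih =>
      rw [Finset.sum_Ioc_succ_top (by omega), flux_succ hr, hgen l (by omega)]
      have := mul_le_mul_of_nonneg_left (hcon (l + 1) (by omega)) (symm_pos hr (l + 1)).le
      linarith
  have h1 := sub_eq_sum_flux hr u hiM
  have h2 : ∑ j ∈ Finset.Ico i M, flux lam mu u j * (1 / (lam j * symm lam mu j)) ≤
      -((∑ j ∈ Finset.Ico i M, 1 / (lam j * symm lam mu j) *
        ∑ l ∈ Finset.Ioc j M, symm lam mu l) * ε) := by
    rw [Finset.sum_mul, ← Finset.sum_neg_distrib]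
    refine Finset.sum_le_sum fun j hj => ?_
    obtain ⟨hj1, hj2⟩ := Finset.mem_Ico.1 hj
    have h3 := hflux j M hj1 hj2.le
    have h4 := hneg M hiM
    have h5 := one_div_nonneg.2 (conductance_pos hr j).le
    nlinarith [mul_nonneg h5 (show 0 ≤ -(flux lam mu u j +
      ε * ∑ x ∈ Finset.Ioc j M, symm lam mu x) by linarith)]
  linarith [hu M]

end Sequences

/-! ### Naturality in terms of the chain and of its Siegmund dual -/

section Natural

variable {lam mu : ℕ → ℝ}

theorem IsRates.dual (hr : IsRates lam mu) : IsRates (dualBirth mu) (dualDeath lam) :=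
  ⟨hr.death_pos, (hr.birth_pos 0).le, fun x => hr.birth_pos (x + 1)⟩

theorem symm_dual (hr : IsRates lam mu) (x : ℕ) :
    symm (dualBirth mu) (dualDeath lam) x = lam 0 * (1 / (lam x * symm lam mu x)) := by
  induction x with
  | zero => simp [symm_zero, (hr.birth_pos 0).ne']
  | succ x ih =>
    have h1 : symm (dualBirth mu) (dualDeath lam) (x + 1) =
        symm (dualBirth mu) (dualDeath lam) x * (mu (x + 1) / lam (x + 1)) := by
      simp only [symm, Finset.prod_range_succ, dualBirth, dualDeath]
    have h2 := symm_succ_mul hr x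
    have h3 := (hr.birth_pos x).ne'
    have h4 := (hr.birth_pos (x + 1)).ne'
    have h5 := (symm_pos hr x).ne'
    have h6 := (symm_pos hr (x + 1)).ne'
    rw [h1, ih, ← h2]
    have h7 := (hr.death_pos x).ne'
    field_simp

/-- Duality exchanges, up to the factor `lam 0` and a shift, the symmetrizing measure and the
inverse conductances. This is why the first naturality series controls the dual chain. -/
theorem inv_conductance_dual (hr : IsRates lam mu) (x : ℕ) :
    1 / (dualBirth mu x * symm (dualBirth mu) (dualDeath lam) x) =
      symm lam mu (x + 1) / lam 0 := by
  rw [symm_dual hr, ← symm_succ_mul hr x]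
  have h1 := (hr.birth_pos 0).ne'
  have h6 := (symm_pos hr (x + 1)).ne'
  have h7 := (hr.death_pos x).ne'
  unfold dualBirth
  field_simp

theorem Ioc_eq_Ico_succ (j M : ℕ) : Finset.Ioc j M = Finset.Ico (j + 1) (M + 1) := by
  ext x
  simp only [Finset.mem_Ioc, Finset.mem_Ico]
  omega

theorem sum_Ioc_eq_sum_range (f : ℕ → ℝ) (j M : ℕ) :
    ∑ l ∈ Finset.Ioc j M, f l = ∑ l ∈ Finset.range (M - j), f (j + 1 + l) := by
  rw [Ioc_eq_Ico_succ, Finset.sum_Ico_eq_sum_range, Nat.add_sub_add_right]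

/-- A bound on the finite double sums would make π summable (look at the term `j = i`); letting the
inner range grow would then make the second naturality series finite. -/
theorem NaturalAtInfinity.notEntrance (hr : IsRates lam mu) (h : NaturalAtInfinity lam mu) :
    NotEntrance lam mu := by
  intro i B
  by_contra hcon
  push Not at hcon
  have hB : ∀ M, ∑ j ∈ Finset.Ico i M, 1 / (lam j * symm lam mu j) *
      ∑ l ∈ Finset.Ioc j M, symm lam mu l ≤ B := fun M => by
    rw [← sum_Ioc_mul_sum_Ico]; exact hcon M
  have hpi : ∀ x, 0 ≤ symm lam mu x := fun x => (symm_pos hr x).le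
  have ha : ∀ x, 0 < 1 / (lam x * symm lam mu x) := fun x => one_div_pos.2 (conductance_pos hr x)
  have hIoc : ∀ j M, ∑ l ∈ Finset.Ioc j M, symm lam mu l =
      ∑ l ∈ Finset.range (M - j), symm lam mu (j + 1 + l) := fun j M => sum_Ioc_eq_sum_range _ j M
  have hS : ∀ j, Summable fun l => symm lam mu (j + 1 + l) := by
    have h0 : Summable fun l => symm lam mu (i + 1 + l) := by
      refine summable_of_sum_range_le (c := max 0 (B / (1 / (lam i * symm lam mu i))))
        (fun l => hpi _) fun n => ?_
      rcases Nat.eq_zero_or_pos n with rfl | hn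
      · simp
      refine le_max_of_le_right ?_
      rw [le_div_iff₀ (ha i), mul_comm]
      refine le_trans ?_ (hB (i + n))
      have := hIoc i (i + n)
      rw [Nat.add_sub_cancel_left] at this
      rw [← this]
      exact Finset.single_le_sum (f := fun j => 1 / (lam j * symm lam mu j) *
        ∑ l ∈ Finset.Ioc j (i + n), symm lam mu l)
        (fun j _ => mul_nonneg (ha j).le (Finset.sum_nonneg fun l _ => hpi l))
        (Finset.mem_Ico.2 ⟨le_rfl, by omega⟩)
    have h1 : Summable (symm lam mu) := by
      rw [← summable_nat_add_iff (i + 1)]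
      simpa only [add_comm] using h0
    intro j
    have := (summable_nat_add_iff (j + 1)).2 h1
    simpa only [add_comm] using this
  set t : ℕ → ℝ := fun j => ∑' l, symm lam mu (j + 1 + l) with ht
  have ht0 : ∀ j, 0 ≤ t j := fun j => tsum_nonneg fun l => hpi _
  have hlim : ∀ j, Tendsto (fun M => ∑ l ∈ Finset.Ioc j M, symm lam mu l) atTop (𝓝 (t j)) := by
    intro j
    simp only [hIoc]
    exact (hS j).hasSum.tendsto_sum_nat.comp (tendsto_sub_atTop_nat j)
  have hle : ∀ J, ∑ j ∈ Finset.Ico i J, 1 / (lam j * symm lam mu j) * t j ≤ B := by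
    intro J
    refine le_of_tendsto (tendsto_finsetSum (Finset.Ico i J) fun j _ =>
      (hlim j).const_mul (1 / (lam j * symm lam mu j))) ?_
    filter_upwards [eventually_ge_atTop J] with M hM
    refine le_trans (Finset.sum_le_sum_of_subset_of_nonneg
      (Finset.Ico_subset_Ico_right hM) fun j _ _ => ?_) (hB M)
    exact mul_nonneg (ha j).le (Finset.sum_nonneg fun l _ => hpi l)
  have hsum : Summable fun j => 1 / (lam j * symm lam mu j) * t j := by
    rw [← summable_nat_add_iff i]
    refine summable_of_sum_range_le (c := B) (fun j => mul_nonneg (ha _).le (ht0 _)) fun n => ?_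
    refine le_trans (le_of_eq ?_) (hle (i + n))
    rw [Finset.sum_Ico_eq_sum_range, Nat.add_sub_cancel_left]
    simp only [add_comm]
  have h2 := h.2
  rw [show (fun j : ℕ => ENNReal.ofReal (1 / (lam j * symm lam mu j)) *
      ∑' i : ℕ, ENNReal.ofReal (symm lam mu (j + 1 + i))) =
      fun j => ENNReal.ofReal (1 / (lam j * symm lam mu j) * t j) from funext fun j => by
        rw [ENNReal.ofReal_mul (ha j).le, ENNReal.ofReal_tsum_of_nonneg (fun l => hpi _) (hS j)],
    ← ENNReal.ofReal_tsum_of_nonneg (fun j => mul_nonneg (ha j).le (ht0 j)) hsum] at h2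
  exact ENNReal.ofReal_ne_top h2

theorem NaturalAtInfinity.notEntrance_dual (hr : IsRates lam mu) (h : NaturalAtInfinity lam mu) :
    NotEntrance (dualBirth mu) (dualDeath lam) := by
  intro i B
  by_contra hcon
  push Not at hcon
  have hpi : ∀ x, 0 ≤ symm lam mu x := fun x => (symm_pos hr x).le
  have ha : ∀ x, 0 < 1 / (lam x * symm lam mu x) := fun x => one_div_pos.2 (conductance_pos hr x)
  set D : ℕ → ℝ := fun l => ∑ j ∈ Finset.Ico i l, symm lam mu (j + 1) with hD
  set S : ℕ → ℝ := fun l => ∑ j ∈ Finset.range (l + 1), symm lam mu j with hS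
  have hS0 : ∀ l, 0 ≤ S l := fun l => Finset.sum_nonneg fun j _ => hpi j
  have hB : ∀ M, ∑ l ∈ Finset.Ioc i M, 1 / (lam l * symm lam mu l) * D l ≤ B := by
    intro M
    refine le_trans (le_of_eq (Finset.sum_congr rfl fun l _ => ?_)) (hcon M)
    simp only [inv_conductance_dual hr, ← Finset.sum_div]
    have := (hr.birth_pos 0).ne'
    rw [symm_dual hr, mul_comm (lam 0), mul_assoc, mul_div_cancel₀ _ this]
  -- The dual double sum involves only the mass `D l` of `(i, l]`, whereas the first naturality
  -- series involves the full mass `S l`. The missing part `S i` is absorbed by the constant, since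
  -- `D l` is at least π(i+1) when `i < l`.
  set c : ℝ := 1 + S i / symm lam mu (i + 1) with hc
  have hc0 : 0 ≤ c := add_nonneg zero_le_one (div_nonneg (hS0 i) (hpi _))
  have hSD : ∀ l, i < l → S l ≤ c * D l := by
    intro l hl
    have h1 : S l = S i + D l := by
      simp only [hS, hD]
      rw [← Finset.sum_range_add_sum_Ico _ (show i + 1 ≤ l + 1 by omega),
        Finset.sum_Ico_add' (symm lam mu) i l 1]
    have h2 : symm lam mu (i + 1) ≤ D l :=
      Finset.single_le_sum (f := fun j => symm lam mu (j + 1)) (fun j _ => hpi _)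
        (Finset.mem_Ico.2 ⟨le_rfl, hl⟩)
    have h3 : S i ≤ S i / symm lam mu (i + 1) * D l := by
      rw [div_mul_eq_mul_div, le_div_iff₀ (symm_pos hr _)]
      exact mul_le_mul_of_nonneg_left h2 (hS0 i)
    rw [h1, hc, add_mul, one_mul]
    linarith
  have hsum : Summable fun l => 1 / (lam l * symm lam mu l) * S l := by
    rw [← summable_nat_add_iff (i + 1)]
    refine summable_of_sum_range_le (c := c * B)
      (fun l => mul_nonneg (ha _).le (hS0 _)) fun n => ?_
    refine le_trans ?_ (mul_le_mul_of_nonneg_left (hB (i + n)) hc0)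
    rw [sum_Ioc_eq_sum_range, Nat.add_sub_cancel_left, Finset.mul_sum]
    refine Finset.sum_le_sum fun l _ => ?_
    rw [add_comm l (i + 1), mul_left_comm]
    exact mul_le_mul_of_nonneg_left (hSD _ (by omega)) (ha _).le
  have h1 := h.1
  rw [show (fun j : ℕ => ENNReal.ofReal (1 / (lam j * symm lam mu j)) *
      ∑ i ∈ Finset.range (j + 1), ENNReal.ofReal (symm lam mu i)) =
      fun j => ENNReal.ofReal (1 / (lam j * symm lam mu j) * S j) from funext fun j => by
        rw [ENNReal.ofReal_mul (ha j).le, ENNReal.ofReal_sum_of_nonneg fun l _ => hpi l],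
    ← ENNReal.ofReal_tsum_of_nonneg (fun j => mul_nonneg (ha j).le (hS0 j)) hsum] at h1
  exact ENNReal.ofReal_ne_top h1

end Natural

/-! ### Recurrences and duality of the orthogonal polynomials -/

section Polynomials

variable {lam mu : ℕ → ℝ}

theorem neg_X_mul_orthoPoly_zero (hr : IsRates lam mu) :
    -X * orthoPoly lam mu 0 =
      C (lam 0) * (orthoPoly lam mu 1 - orthoPoly lam mu 0) - C (mu 0) * orthoPoly lam mu 0 := by
  have h : (C (lam 0) * C (lam 0)⁻¹ : ℝ[X]) = 1 := by
    rw [← C_mul, mul_inv_cancel₀ (hr.birth_pos 0).ne', C_1]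
  simp only [orthoPoly, C_add]
  linear_combination (X - C (lam 0) - C (mu 0)) * h

theorem neg_X_mul_orthoPoly_succ (hr : IsRates lam mu) (m : ℕ) :
    -X * orthoPoly lam mu (m + 1) =
      C (lam (m + 1)) * (orthoPoly lam mu (m + 2) - orthoPoly lam mu (m + 1)) -
        C (mu (m + 1)) * (orthoPoly lam mu (m + 1) - orthoPoly lam mu m) := by
  have h : (C (lam (m + 1)) * C (lam (m + 1))⁻¹ : ℝ[X]) = 1 := by
    rw [← C_mul, mul_inv_cancel₀ (hr.birth_pos (m + 1)).ne', C_1]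
  rw [orthoPoly, C_add]
  linear_combination (-((C (lam (m + 1)) + C (mu (m + 1)) - X) * orthoPoly lam mu (m + 1) -
    C (mu (m + 1)) * orthoPoly lam mu m)) * h

/-- The three-term recurrence survives any linear functional. Used with integration against a
density, it turns multiplication by `X` into minus the generator. -/
theorem gen_linearMap (hr : IsRates lam mu) (T : ℝ[X] →ₗ[ℝ] ℝ) (p : ℝ[X]) (m : ℕ) :
    gen lam mu (fun m => T (orthoPoly lam mu m * p)) m = -T (orthoPoly lam mu m * (X * p)) := by
  have hC : ∀ (c : ℝ) (q : ℝ[X]), T (C c * q) = c * T q := fun c q => by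
    rw [← smul_eq_C_mul, map_smul, smul_eq_mul]
  cases m with
  | zero =>
    have h := congrArg (fun q => T (q * p)) (neg_X_mul_orthoPoly_zero hr)
    simp only [sub_mul, mul_assoc, map_sub, hC] at h
    rw [neg_mul, map_neg] at h
    rw [mul_left_comm, h]
    simp only [gen]
  | succ m =>
    have h := congrArg (fun q => T (q * p)) (neg_X_mul_orthoPoly_succ hr m)
    simp only [sub_mul, mul_assoc, map_sub, hC] at h
    rw [neg_mul, map_neg] at h
    rw [mul_left_comm, h]
    simp only [gen]

/-- A linear property of polynomials holds if it holds for the polynomials of the chain. -/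
theorem orthoPoly_induction (hr : IsRates lam mu) {P : ℝ[X] → Prop}
    (hadd : ∀ p q, P p → P q → P (p + q)) (hsmul : ∀ (c : ℝ) p, P p → P (c • p))
    (hQ : ∀ m, P (orthoPoly lam mu m)) (p : ℝ[X]) : P p := by
  let S : Submodule ℝ ℝ[X] := Submodule.span ℝ (Set.range (orthoPoly lam mu))
  have hmem : ∀ m, orthoPoly lam mu m ∈ S := fun m => Submodule.subset_span ⟨m, rfl⟩
  have hX : ∀ q ∈ S, X * q ∈ S := by
    intro q hq
    induction hq using Submodule.span_induction with
    | mem q hq =>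
      obtain ⟨m, rfl⟩ := hq
      rw [← neg_mem_iff, ← neg_mul]
      cases m with
      | zero =>
        rw [neg_X_mul_orthoPoly_zero hr, ← smul_eq_C_mul, ← smul_eq_C_mul]
        exact S.sub_mem (S.smul_mem _ (S.sub_mem (hmem _) (hmem _))) (S.smul_mem _ (hmem _))
      | succ m =>
        rw [neg_X_mul_orthoPoly_succ hr, ← smul_eq_C_mul, ← smul_eq_C_mul]
        exact S.sub_mem (S.smul_mem _ (S.sub_mem (hmem _) (hmem _)))
          (S.smul_mem _ (S.sub_mem (hmem _) (hmem _)))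
    | zero => simp
    | add a b _ _ ha hb => rw [mul_add]; exact S.add_mem ha hb
    | smul c a _ ha => rw [mul_smul_comm]; exact S.smul_mem c ha
  have hpow : ∀ n : ℕ, (X ^ n : ℝ[X]) ∈ S := by
    intro n
    induction n with
    | zero => simpa [orthoPoly] using hmem 0
    | succ n ih => rw [pow_succ']; exact hX _ ih
  have hp : p ∈ S := by
    rw [p.as_sum_range_C_mul_X_pow]
    refine S.sum_mem fun i _ => ?_
    rw [← smul_eq_C_mul]
    exact S.smul_mem _ (hpow i)
  induction hp using Submodule.span_induction with
  | mem q hq => obtain ⟨m, rfl⟩ := hq; exact hQ m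
  | zero => simpa using hsmul 0 _ (hQ 0)
  | add a b _ _ ha hb => exact hadd _ _ ha hb
  | smul c a _ ha => exact hsmul _ _ ha

theorem gen_orthoPoly_eval (hr : IsRates lam mu) (x : ℝ) (m : ℕ) :
    gen lam mu (fun m => (orthoPoly lam mu m).eval x) m = -(x * (orthoPoly lam mu m).eval x) := by
  have h := gen_linearMap hr (Polynomial.leval x) 1 m
  simp only [mul_one, leval_apply, eval_mul, eval_X] at h
  rw [h, mul_comm]

/-- Summing `L q = -x q` against π shows that the flux of `q` is -x times the partial sums of πq; no
boundary term appears because `mu 0 = 0`. These partial sums satisfy the dual recurrence, hence are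
the dual polynomials. -/
theorem eval_orthoPoly_dual (hr : IsRates lam mu) (hmu0 : mu 0 = 0) (x : ℝ) (m : ℕ) :
    (orthoPoly (dualBirth mu) (dualDeath lam) m).eval x =
      ∑ i ∈ Finset.range (m + 1), symm lam mu i * (orthoPoly lam mu i).eval x ∧
    flux lam mu (fun m => (orthoPoly lam mu m).eval x) m =
      -(x * (orthoPoly (dualBirth mu) (dualDeath lam) m).eval x) := by
  set q : ℕ → ℝ := fun m => (orthoPoly lam mu m).eval x with hq
  set q' : ℕ → ℝ := fun m => (orthoPoly (dualBirth mu) (dualDeath lam) m).eval x with hq'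
  have hg := gen_orthoPoly_eval hr x
  have hg' := gen_orthoPoly_eval hr.dual x
  rw [← hq] at hg
  rw [← hq'] at hg'
  have h0 : q 0 = 1 := by simp [hq, orthoPoly]
  have h0' : q' 0 = 1 := by simp [hq', orthoPoly]
  change q' m = ∑ i ∈ Finset.range (m + 1), symm lam mu i * q i ∧
    flux lam mu q m = -(x * q' m)
  have hfl : ∀ m, flux lam mu q m =
      -(x * ∑ i ∈ Finset.range (m + 1), symm lam mu i * q i) := by
    intro m
    induction m with
    | zero => rw [flux_zero, hg, hmu0]; simp only [symm_zero, zero_mul, zero_add, add_zero, Finset.sum_range_one, one_mul, hq]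
    | succ m ih =>
      rw [flux_succ hr, hg, ih, Finset.sum_range_succ _ (m + 1)]
      change _ + _ * -(x * q (m + 1)) = _
      ring
  suffices h : ∀ m, q' m = ∑ i ∈ Finset.range (m + 1), symm lam mu i * q i from
    ⟨h m, by rw [hfl, ← h m]⟩
  intro m
  induction m using Nat.twoStepInduction with
  | zero => simp [symm_zero, h0, h0']
  | one =>
    have e1 := hg' 0
    have e2 := hg 0
    have e3 := symm_succ_mul hr 0
    change dualBirth mu 0 * (q' 1 - q' 0) - dualDeath lam 0 * q' 0 = -(x * q' 0) at e1
    change lam 0 * (q 1 - q 0) - mu 0 * q 0 = -(x * q 0) at e2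
    simp only [dualBirth, dualDeath, zero_add, h0', hmu0, h0, symm_zero] at e1 e2 e3
    have hne := (hr.death_pos 0).ne'
    simp only [zero_add] at hne
    simp only [Finset.sum_range_succ, Finset.sum_range_zero, symm_zero, h0, zero_add]
    apply mul_left_cancel₀ hne
    linear_combination e1 - e2 - q 1 * e3
  | more m ih0 ih1 =>
    have e1 := hg' (m + 1)
    change dualBirth mu (m + 1) * (q' (m + 2) - q' (m + 1)) -
      dualDeath lam (m + 1) * (q' (m + 1) - q' m) = -(x * q' (m + 1)) at e1
    have e2 := hfl (m + 1)
    rw [← ih1, flux] at e2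
    have e3 := symm_succ_mul hr (m + 1)
    have e4 : q' (m + 1) - q' m = symm lam mu (m + 1) * q (m + 1) := by
      rw [ih1, ih0, Finset.sum_range_succ _ (m + 1)]; ring
    have hne := (hr.death_pos (m + 1)).ne'
    rw [Finset.sum_range_succ, ← ih1]
    simp only [dualBirth, dualDeath] at e1
    apply mul_left_cancel₀ hne
    linear_combination e1 - e2 - q (m + 2) * e3 + lam (m + 1) * e4

theorem orthoPoly_dual_eq_sum (hr : IsRates lam mu) (hmu0 : mu 0 = 0) (m : ℕ) :
    orthoPoly (dualBirth mu) (dualDeath lam) m =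
      ∑ i ∈ Finset.range (m + 1), C (symm lam mu i) * orthoPoly lam mu i := by
  refine Polynomial.funext fun x => ?_
  rw [(eval_orthoPoly_dual hr hmu0 x m).1, eval_finsetSum]
  simp

theorem orthoPoly_succ_sub (hr : IsRates lam mu) (hmu0 : mu 0 = 0) (m : ℕ) :
    C (lam 0) * (orthoPoly lam mu (m + 1) - orthoPoly lam mu m) =
      -(X * (C (symm (dualBirth mu) (dualDeath lam) m) *
        orthoPoly (dualBirth mu) (dualDeath lam) m)) := by
  refine Polynomial.funext fun x => ?_
  have h := (eval_orthoPoly_dual hr hmu0 x m).2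
  have h1 := sub_eq_flux_div hr (fun m => (orthoPoly lam mu m).eval x) m
  rw [h] at h1
  simp only [eval_mul, eval_C, eval_sub, eval_neg, eval_X, symm_dual hr, h1]
  ring

theorem orthoPoly_eval_zero (hr : IsRates lam mu) (hmu0 : mu 0 = 0) (m : ℕ) :
    (orthoPoly lam mu m).eval 0 = 1 := by
  induction m with
  | zero => simp [orthoPoly]
  | succ m ih =>
    have h := congrArg (eval 0) (orthoPoly_succ_sub hr hmu0 m)
    simp only [eval_mul, eval_C, eval_sub, eval_neg, eval_X, zero_mul, neg_zero, ih] at h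
    have := (mul_eq_zero.1 h).resolve_left (hr.birth_pos 0).ne'
    linarith

theorem sum_symm_dual_mul_orthoPoly_dual (hr : IsRates lam mu) (hmu0 : mu 0 = 0) {i m : ℕ}
    (h : i ≤ m) :
    X * ∑ l ∈ Finset.Ico i m, C (symm (dualBirth mu) (dualDeath lam) l) *
      orthoPoly (dualBirth mu) (dualDeath lam) l =
      C (lam 0) * (orthoPoly lam mu i - orthoPoly lam mu m) := by
  induction m, h using Nat.le_induction with
  | base => simp
  | succ m hm ih =>
    rw [Finset.sum_Ico_succ_top hm, mul_add, ih]
    linear_combination orthoPoly_succ_sub hr hmu0 m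

end Polynomials

/-! ### Polynomials integrated against bounded densities -/

section Measure

variable {w : Measure ℝ}

/-- Essentially bounded functions. -/
structure Bdd (w : Measure ℝ) (f : ℝ → ℝ) : Prop where
  meas : AEStronglyMeasurable f w
  bound : ∃ c, ∀ᵐ x ∂w, |f x| ≤ c

theorem Bdd.const (c : ℝ) : Bdd w fun _ => c :=
  ⟨aestronglyMeasurable_const, |c|, Eventually.of_forall fun _ => le_rfl⟩

theorem Bdd.add {f g : ℝ → ℝ} (hf : Bdd w f) (hg : Bdd w g) : Bdd w fun x => f x + g x := by
  obtain ⟨c, hc⟩ := hf.bound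
  obtain ⟨d, hd⟩ := hg.bound
  refine ⟨hf.meas.add hg.meas, c + d, ?_⟩
  filter_upwards [hc, hd] with x h1 h2
  exact (abs_add_le _ _).trans (add_le_add h1 h2)

theorem Bdd.mul {f g : ℝ → ℝ} (hf : Bdd w f) (hg : Bdd w g) : Bdd w fun x => f x * g x := by
  obtain ⟨c, hc⟩ := hf.bound
  obtain ⟨d, hd⟩ := hg.bound
  refine ⟨hf.meas.mul hg.meas, c * d, ?_⟩
  filter_upwards [hc, hd] with x h1 h2
  rw [abs_mul]
  exact mul_le_mul h1 h2 (abs_nonneg _) ((abs_nonneg _).trans h1)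

theorem Bdd.sub {f g : ℝ → ℝ} (hf : Bdd w f) (hg : Bdd w g) : Bdd w fun x => f x - g x := by
  simpa [sub_eq_add_neg] using hf.add ((Bdd.const (-1)).mul hg)

theorem Bdd.pow {f : ℝ → ℝ} (hf : Bdd w f) (n : ℕ) : Bdd w fun x => f x ^ n := by
  induction n with
  | zero => simpa using Bdd.const 1
  | succ n ih => simpa only [pow_succ] using ih.mul hf

theorem Bdd.congr {f g : ℝ → ℝ} (hf : Bdd w f) (h : f =ᵐ[w] g) : Bdd w g := by
  obtain ⟨c, hc⟩ := hf.bound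
  refine ⟨hf.meas.congr h, c, ?_⟩
  filter_upwards [hc, h] with x h1 h2
  rwa [← h2]

theorem integrable_eval (hw : ∀ m : ℕ, Integrable (fun x : ℝ => x ^ m) w) (p : ℝ[X]) :
    Integrable (fun x => p.eval x) w := by
  simp only [eval_eq_sum_range]
  exact integrable_finsetSum _ fun i _ => (hw i).const_mul _

theorem integrable_eval_mul (hw : ∀ m : ℕ, Integrable (fun x : ℝ => x ^ m) w) {f : ℝ → ℝ}
    (hf : Bdd w f) (p : ℝ[X]) : Integrable (fun x => p.eval x * f x) w := by
  obtain ⟨c, hc⟩ := hf.bound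
  exact (integrable_eval hw p).mul_bdd hf.meas hc

/-- Integration of polynomials against a bounded density. -/
def polyInt (hw : ∀ m : ℕ, Integrable (fun x : ℝ => x ^ m) w) {f : ℝ → ℝ} (hf : Bdd w f) :
    ℝ[X] →ₗ[ℝ] ℝ where
  toFun p := ∫ x, p.eval x * f x ∂w
  map_add' p q := by
    simp only [eval_add, add_mul]
    exact integral_add (integrable_eval_mul hw hf p) (integrable_eval_mul hw hf q)
  map_smul' c p := by
    simp only [eval_smul, smul_eq_mul, mul_assoc, RingHom.id_apply]
    exact integral_const_mul _ _

theorem polyInt_apply (hw : ∀ m : ℕ, Integrable (fun x : ℝ => x ^ m) w) {f : ℝ → ℝ}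
    (hf : Bdd w f) (p : ℝ[X]) : polyInt hw hf p = ∫ x, p.eval x * f x ∂w := rfl

theorem polyInt_C_mul (hw : ∀ m : ℕ, Integrable (fun x : ℝ => x ^ m) w) {f : ℝ → ℝ}
    (hf : Bdd w f) (c : ℝ) (p : ℝ[X]) : polyInt hw hf (C c * p) = c * polyInt hw hf p := by
  rw [← smul_eq_C_mul, map_smul, smul_eq_mul]

theorem polyInt_congr (hw : ∀ m : ℕ, Integrable (fun x : ℝ => x ^ m) w) {f g : ℝ → ℝ}
    (hf : Bdd w f) (hg : Bdd w g) {p q : ℝ[X]} (h : ∀ᵐ x ∂w, p.eval x * f x = q.eval x * g x) :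
    polyInt hw hf p = polyInt hw hg q :=
  integral_congr_ae h

theorem tendsto_polyInt (hw : ∀ m : ℕ, Integrable (fun x : ℝ => x ^ m) w) {f : ℕ → ℝ → ℝ}
    {g : ℝ → ℝ} (hf : ∀ n, Bdd w (f n)) (hg : Bdd w g) {c : ℝ}
    (hc : ∀ᶠ n in atTop, ∀ᵐ x ∂w, |f n x| ≤ c)
    (hlim : ∀ᵐ x ∂w, Tendsto (fun n => f n x) atTop (𝓝 (g x))) (p : ℝ[X]) :
    Tendsto (fun n => polyInt hw (hf n) p) atTop (𝓝 (polyInt hw hg p)) := by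
  simp only [polyInt_apply]
  refine tendsto_integral_filter_of_dominated_convergence (fun x => |p.eval x| * c)
    (Eventually.of_forall fun n => (integrable_eval_mul hw (hf n) p).1) ?_
    ((integrable_eval hw p).abs.mul_const c) ?_
  · filter_upwards [hc] with n hn
    filter_upwards [hn] with x hx
    rw [norm_mul]
    exact mul_le_mul_of_nonneg_left hx (abs_nonneg _)
  · filter_upwards [hlim] with x hx using hx.const_mul _

end Measure

/-! ### Bessel's inequality and positivity of resolvents -/

section Spectral

variable {lam mu : ℕ → ℝ} {w : Measure ℝ}

theorem IsSpectralMeasure.ae_nonneg (hw : IsSpectralMeasure lam mu w) : ∀ᵐ x ∂w, 0 ≤ x := by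
  rw [ae_iff]
  simp only [not_le]
  exact hw.support

theorem IsSpectralMeasure.polyInt_one (hw : IsSpectralMeasure lam mu w) (i j : ℕ) :
    polyInt hw.moments (Bdd.const 1) (orthoPoly lam mu i * orthoPoly lam mu j) =
      if i = j then 1 / symm lam mu j else 0 := by
  rw [← hw.orthogonal i j, polyInt_apply]
  simp only [eval_mul, mul_one]

/-- Bessel's inequality for the polynomials of the chain. -/
theorem summable_symm_mul_sq (hr : IsRates lam mu) (hw : IsSpectralMeasure lam mu w) {f : ℝ → ℝ}
    (hf : Bdd w f) (p : ℝ[X]) :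
    Summable fun m => symm lam mu m * polyInt hw.moments hf (orthoPoly lam mu m * p) ^ 2 := by
  set u : ℕ → ℝ := fun m => polyInt hw.moments hf (orthoPoly lam mu m * p) with hu
  refine summable_of_sum_range_le (c := ∫ x, (p * p).eval x * (f x * f x) ∂w)
    (fun m => mul_nonneg (symm_pos hr m).le (sq_nonneg _)) fun M => ?_
  set S : ℝ[X] := ∑ m ∈ Finset.range M, C (symm lam mu m * u m) * orthoPoly lam mu m with hS
  have h1 : polyInt hw.moments hf (S * p) =
      ∑ m ∈ Finset.range M, symm lam mu m * u m ^ 2 := by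
    rw [hS, Finset.sum_mul, map_sum]
    refine Finset.sum_congr rfl fun m _ => ?_
    rw [mul_assoc, polyInt_C_mul]
    simp only [hu]
    ring
  have h2 : polyInt hw.moments (Bdd.const 1) (S * S) =
      ∑ m ∈ Finset.range M, symm lam mu m * u m ^ 2 := by
    conv_lhs => rw [hS, Finset.sum_mul, map_sum]
    refine Finset.sum_congr rfl fun m hm => ?_
    rw [Finset.mul_sum, map_sum, Finset.sum_eq_single m]
    · rw [mul_mul_mul_comm, ← C_mul, polyInt_C_mul, hw.polyInt_one, if_pos rfl]
      have := (symm_pos hr m).ne'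
      field_simp
    · intro l _ hl
      rw [mul_mul_mul_comm, ← C_mul, polyInt_C_mul, hw.polyInt_one, if_neg hl.symm, mul_zero]
    · exact fun h => absurd hm h
  rw [polyInt_apply] at h1 h2
  have i1 := integrable_eval_mul hw.moments (hf.mul hf) (p * p)
  have i2 := integrable_eval_mul hw.moments hf (S * p)
  have i3 := integrable_eval_mul hw.moments (Bdd.const 1) (S * S)
  -- The integrand is `(p f - S)²`, where `S` is the partial Fourier sum of `p f`.
  have h3 : 0 ≤ ∫ x, (((p * p).eval x * (f x * f x) - 2 * ((S * p).eval x * f x)) +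
      (S * S).eval x * 1) ∂w := by
    refine integral_nonneg fun x => ?_
    simp only [eval_mul, Pi.zero_apply]
    nlinarith [sq_nonneg (p.eval x * f x - S.eval x)]
  rw [integral_add (by exact i1.sub (i2.const_mul 2)) i3, integral_sub i1 (i2.const_mul 2),
    integral_const_mul, h1, h2] at h3
  linarith

/-- Bounded densities against which all products `Qᵢ Qⱼ` have nonnegative integrals. -/
structure PosType (lam mu : ℕ → ℝ) (w : Measure ℝ) (f : ℝ → ℝ) : Prop where
  bdd : Bdd w f
  nonneg : ∀ i j, 0 ≤ ∫ x, (orthoPoly lam mu i * orthoPoly lam mu j).eval x * f x ∂w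

theorem PosType.congr {f g : ℝ → ℝ} (hf : PosType lam mu w f) (h : f =ᵐ[w] g) :
    PosType lam mu w g := by
  refine ⟨hf.bdd.congr h, fun i j => (hf.nonneg i j).trans_eq (integral_congr_ae ?_)⟩
  filter_upwards [h] with x hx
  rw [hx]

theorem PosType.zero : PosType lam mu w fun _ => 0 :=
  ⟨Bdd.const 0, fun i j => by simp⟩

theorem PosType.one (hr : IsRates lam mu) (hw : IsSpectralMeasure lam mu w) :
    PosType lam mu w fun _ => 1 := by
  refine ⟨Bdd.const 1, fun i j => ?_⟩
  rw [← polyInt_apply hw.moments (Bdd.const 1), hw.polyInt_one]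
  split_ifs
  · exact one_div_nonneg.2 (symm_pos hr j).le
  · exact le_rfl

theorem PosType.add (hw : IsSpectralMeasure lam mu w) {f g : ℝ → ℝ} (hf : PosType lam mu w f)
    (hg : PosType lam mu w g) : PosType lam mu w fun x => f x + g x := by
  refine ⟨hf.bdd.add hg.bdd, fun i j => ?_⟩
  simp only [mul_add]
  rw [integral_add (integrable_eval_mul hw.moments hf.bdd _)
    (integrable_eval_mul hw.moments hg.bdd _)]
  exact add_nonneg (hf.nonneg i j) (hg.nonneg i j)

theorem PosType.const_mul {f : ℝ → ℝ} (hf : PosType lam mu w f) {c : ℝ} (hc : 0 ≤ c) :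
    PosType lam mu w fun x => c * f x := by
  refine ⟨(Bdd.const c).mul hf.bdd, fun i j => ?_⟩
  simp only [mul_left_comm _ c]
  rw [integral_const_mul]
  exact mul_nonneg hc (hf.nonneg i j)

theorem PosType.sum (hw : IsSpectralMeasure lam mu w) {f : ℕ → ℝ → ℝ} {N : ℕ}
    (hf : ∀ k < N, PosType lam mu w (f k)) :
    PosType lam mu w fun x => ∑ k ∈ Finset.range N, f k x := by
  induction N with
  | zero => simpa using PosType.zero
  | succ N ih =>
    simp only [Finset.sum_range_succ]
    exact (ih fun k hk => hf k (by omega)).add hw (hf N (by omega))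

theorem bdd_inv_one_add (hw : IsSpectralMeasure lam mu w) {a : ℝ} (ha : 0 ≤ a) :
    Bdd w fun x => (1 + a * x)⁻¹ := by
  refine ⟨by fun_prop, 1, ?_⟩
  filter_upwards [hw.ae_nonneg] with x hx
  have := mul_nonneg ha hx
  rw [abs_of_nonneg (by positivity)]
  exact inv_le_one_of_one_le₀ (by linarith)

/-- The resolvent preserves positivity. -/
theorem PosType.mul_inv_one_add (hr : IsRates lam mu) (hE : NotEntrance lam mu)
    (hw : IsSpectralMeasure lam mu w) {f : ℝ → ℝ} (hf : PosType lam mu w f) {a : ℝ}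
    (ha : 0 ≤ a) : PosType lam mu w fun x => f x * (1 + a * x)⁻¹ := by
  have hg : Bdd w fun x => f x * (1 + a * x)⁻¹ := hf.bdd.mul (bdd_inv_one_add hw ha)
  refine ⟨hg, fun i j => ?_⟩
  rcases ha.eq_or_lt with rfl | ha
  · simpa using hf.nonneg i j
  set T := polyInt hw.moments hg with hT
  have hres : ∀ p : ℝ[X], T p + a * T (X * p) = ∫ x, p.eval x * f x ∂w := by
    intro p
    rw [← polyInt_apply hw.moments hf.bdd, ← polyInt_C_mul, ← map_add]
    refine polyInt_congr _ _ _ ?_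
    filter_upwards [hw.ae_nonneg] with x hx
    have : 1 + a * x ≠ 0 := by positivity
    simp only [eval_add, eval_mul, eval_C, eval_X]
    field_simp
  have hs := summable_symm_mul_sq hr hw hg (orthoPoly lam mu j)
  -- By `hres`, the function `u m = T (Q_m Q_j)` satisfies `u - a L u = ∫ Q_m Q_j f ≥ 0`, so `-u` is
  -- a square summable subsolution.
  have h := nonpos_of_subsolution hr hE ha
    (v := fun m => -T (orthoPoly lam mu m * orthoPoly lam mu j)) (fun m => ?_)
    (by simpa only [neg_sq] using hs) i
  · exact neg_nonpos.1 h
  · have h1 := gen_linearMap hr (-T) (orthoPoly lam mu j) m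
    simp only [LinearMap.neg_apply] at h1
    rw [h1, neg_neg]
    have h2 := hres (orthoPoly lam mu m * orthoPoly lam mu j)
    rw [mul_left_comm] at h2
    linarith [hf.nonneg m j]

theorem PosType.inv_one_add_pow (hr : IsRates lam mu) (hE : NotEntrance lam mu)
    (hw : IsSpectralMeasure lam mu w) {a : ℝ} (ha : 0 ≤ a) (N : ℕ) :
    PosType lam mu w fun x => (1 + a * x)⁻¹ ^ N := by
  induction N with
  | zero => simpa using PosType.one hr hw
  | succ N ih => simpa only [pow_succ] using ih.mul_inv_one_add hr hE hw ha

/-- Iterated resolvent identity for 1/(1+x) and r = 1/(1+ax). It is a discrete form of 1/(1+x) =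
∫₀^∞ e^{-s} e^{-sx} ds, cut off after N steps, and writes 1/(1+x) as a positive combination of
powers of r plus a remainder. -/
theorem inv_one_add_sub_sum {a x : ℝ} (ha : 0 ≤ a) (hx : 0 ≤ x) (N : ℕ) :
    (1 + x)⁻¹ - ∑ k ∈ Finset.range N, a * ((1 - a) ^ k * (1 + a * x)⁻¹ ^ (k + 1)) =
      (1 - a) ^ N * ((1 + a * x)⁻¹ ^ N * (1 + x)⁻¹) := by
  induction N with
  | zero => simp
  | succ N ih =>
    rw [Finset.sum_range_succ, ← sub_sub, ih]
    have h1 : 1 + x ≠ 0 := by positivity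
    have h2 : 1 + a * x ≠ 0 := by positivity
    have h3 : (1 + x)⁻¹ - a * (1 + a * x)⁻¹ = (1 - a) * ((1 + a * x)⁻¹ * (1 + x)⁻¹) := by
      field_simp
      ring
    linear_combination (1 - a) ^ N * (1 + a * x)⁻¹ ^ N * h3

theorem mul_sum_inv_one_add_pow {a x : ℝ} (ha : 0 ≤ a) (hx : 0 ≤ x) (N : ℕ) :
    x * ∑ k ∈ Finset.range N, a * (1 + a * x)⁻¹ ^ (k + 1) = 1 - (1 + a * x)⁻¹ ^ N := by
  induction N with
  | zero => simp
  | succ N ih =>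
    rw [Finset.sum_range_succ, mul_add, ih]
    have h2 : 1 + a * x ≠ 0 := by positivity
    have h3 : (1 + a * x)⁻¹ * (1 + a * x) = 1 := inv_mul_cancel₀ h2
    linear_combination (1 + a * x)⁻¹ ^ N * h3

theorem posType_inv_one_add_sub (hr : IsRates lam mu) (hE : NotEntrance lam mu)
    (hw : IsSpectralMeasure lam mu w) {a : ℝ} (ha : 0 ≤ a) (ha1 : a ≤ 1) (N : ℕ) :
    PosType lam mu w fun x =>
      (1 + x)⁻¹ - (1 - a) ^ N * ((1 + a * x)⁻¹ ^ N * (1 + x)⁻¹) := by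
  have hq : 0 ≤ 1 - a := by linarith
  refine PosType.congr (f := fun x => ∑ k ∈ Finset.range N,
    a * ((1 - a) ^ k * (1 + a * x)⁻¹ ^ (k + 1))) ?_ ?_
  · exact PosType.sum hw fun k _ => ((PosType.inv_one_add_pow hr hE hw ha (k + 1)).const_mul
      (pow_nonneg hq k)).const_mul ha
  · filter_upwards [hw.ae_nonneg] with x hx
    rw [← inv_one_add_sub_sum ha hx]
    ring

/-- Discrete form of e^{-t} ∫₀^t e^{-sx} ds ≤ 1/(1+x) in the order given by `PosType`: replace each
weight (1-a)^k by the smaller (1-a)^N. -/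
theorem posType_inv_one_add_sub_sum (hr : IsRates lam mu) (hE : NotEntrance lam mu)
    (hw : IsSpectralMeasure lam mu w) {a : ℝ} (ha : 0 ≤ a) (ha1 : a ≤ 1) (N : ℕ) :
    PosType lam mu w fun x =>
      (1 + x)⁻¹ - (1 - a) ^ N * ∑ k ∈ Finset.range N, a * (1 + a * x)⁻¹ ^ (k + 1) := by
  have hq : 0 ≤ 1 - a := by linarith
  have hR : PosType lam mu w fun x => (1 + a * x)⁻¹ ^ N * (1 + 1 * x)⁻¹ :=
    (PosType.inv_one_add_pow hr hE hw ha N).mul_inv_one_add hr hE hw zero_le_one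
  refine PosType.congr (f := fun x => (1 - a) ^ N * ((1 + a * x)⁻¹ ^ N * (1 + 1 * x)⁻¹) +
    ∑ k ∈ Finset.range N, (a * ((1 - a) ^ k - (1 - a) ^ N)) * (1 + a * x)⁻¹ ^ (k + 1)) ?_ ?_
  · refine (hR.const_mul (pow_nonneg hq N)).add hw (PosType.sum hw fun k hk =>
      (PosType.inv_one_add_pow hr hE hw ha (k + 1)).const_mul (mul_nonneg ha (sub_nonneg.2 ?_)))
    exact pow_le_pow_of_le_one hq (by linarith) hk.le
  · filter_upwards [hw.ae_nonneg] with x hx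
    rw [one_mul, ← inv_one_add_sub_sum ha hx, Finset.mul_sum, sub_add, ← Finset.sum_sub_distrib]
    congr 1
    exact Finset.sum_congr rfl fun k _ => by ring

end Spectral

/-! ### The semigroup as a limit of resolvent powers, and the Feller property -/

section Semigroup

variable {lam mu : ℕ → ℝ} {w : Measure ℝ}

theorem tendsto_inv_one_add_pow_exp (t x : ℝ) :
    Tendsto (fun N : ℕ => (1 + t / N * x)⁻¹ ^ N) atTop (𝓝 (Real.exp (-(t * x)))) := by
  rw [Real.exp_neg]
  refine ((Real.tendsto_one_add_div_pow_exp (t * x)).inv₀ (Real.exp_pos _).ne').congr fun N => ?_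
  rw [inv_pow, div_mul_eq_mul_div]

theorem tendsto_one_sub_pow_exp (t : ℝ) :
    Tendsto (fun N : ℕ => (1 - t / N) ^ N) atTop (𝓝 (Real.exp (-t))) := by
  refine (Real.tendsto_one_add_div_pow_exp (-t)).congr fun N => ?_
  rw [neg_div, sub_eq_add_neg]

theorem eventually_div_le_one (t : ℝ) : ∀ᶠ N : ℕ in atTop, t / N ≤ 1 := by
  filter_upwards [eventually_ge_atTop ⌈t⌉₊] with N hN
  exact div_le_one_of_le₀ (Nat.ceil_le.1 hN) (Nat.cast_nonneg N)

theorem bdd_exp (hw : IsSpectralMeasure lam mu w) {t : ℝ} (ht : 0 ≤ t) :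
    Bdd w fun x => Real.exp (-(t * x)) := by
  refine ⟨by fun_prop, 1, ?_⟩
  filter_upwards [hw.ae_nonneg] with x hx
  rw [abs_of_pos (Real.exp_pos _), Real.exp_le_one_iff]
  have := mul_nonneg ht hx
  linarith

theorem tendsto_polyInt_exp_of_inv_pow (hw : IsSpectralMeasure lam mu w) {t : ℝ} (ht : 0 ≤ t)
    (p : ℝ[X]) :
    Tendsto (fun N : ℕ => ∫ x, p.eval x * (1 + t / N * x)⁻¹ ^ N ∂w) atTop
      (𝓝 (∫ x, p.eval x * Real.exp (-(t * x)) ∂w)) := by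
  have hN : ∀ N : ℕ, 0 ≤ t / N := fun N => by positivity
  refine tendsto_polyInt hw.moments (fun N => (bdd_inv_one_add hw (hN N)).pow N) (bdd_exp hw ht)
    (c := 1) (Eventually.of_forall fun N => ?_)
    (Eventually.of_forall fun x => tendsto_inv_one_add_pow_exp t x) p
  filter_upwards [hw.ae_nonneg] with x hx
  have := mul_nonneg (hN N) hx
  rw [abs_of_nonneg (by positivity)]
  exact pow_le_one₀ (by positivity) (inv_le_one_of_one_le₀ (by linarith))

/-- The transition probabilities are nonnegative. -/
theorem PosType.exp (hr : IsRates lam mu) (hE : NotEntrance lam mu)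
    (hw : IsSpectralMeasure lam mu w) {t : ℝ} (ht : 0 ≤ t) :
    PosType lam mu w fun x => Real.exp (-(t * x)) := by
  refine ⟨bdd_exp hw ht, fun i j => ?_⟩
  refine ge_of_tendsto' (tendsto_polyInt_exp_of_inv_pow hw ht _) fun N => ?_
  exact (PosType.inv_one_add_pow hr hE hw (by positivity) N).nonneg i j

theorem bdd_resolvent (hw : IsSpectralMeasure lam mu w) : Bdd w fun x => (1 + x)⁻¹ := by
  simpa only [one_mul] using bdd_inv_one_add hw zero_le_one

/-- The resolvent vanishes at infinity. -/
theorem tendsto_resolvent_zero (hr : IsRates lam mu) (hE : NotEntrance lam mu)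
    (hw : IsSpectralMeasure lam mu w) (j : ℕ) :
    Tendsto (fun m => ∫ x, (orthoPoly lam mu m * orthoPoly lam mu j).eval x * (1 + x)⁻¹ ∂w)
      atTop (𝓝 0) := by
  have hR := bdd_resolvent hw
  have hpos : PosType lam mu w fun x => (1 + x)⁻¹ := by
    simpa only [one_mul] using (PosType.one hr hw).mul_inv_one_add hr hE hw zero_le_one
  refine tendsto_zero_of_gen_eq hr hE (fun m => hpos.nonneg m j) (i := j) (fun m hm => ?_)
    (summable_symm_mul_sq hr hw hR (orthoPoly lam mu j))
  have h1 := gen_linearMap hr (polyInt hw.moments hR) (orthoPoly lam mu j) (m + 1)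
  have h2 : polyInt hw.moments hR (orthoPoly lam mu (m + 1) * orthoPoly lam mu j) +
      polyInt hw.moments hR (orthoPoly lam mu (m + 1) * (X * orthoPoly lam mu j)) =
      polyInt hw.moments (Bdd.const 1) (orthoPoly lam mu (m + 1) * orthoPoly lam mu j) := by
    rw [← map_add]
    refine polyInt_congr _ _ _ ?_
    filter_upwards [hw.ae_nonneg] with x hx
    have : 1 + x ≠ 0 := by positivity
    simp only [eval_add, eval_mul, eval_X]
    field_simp
  rw [hw.polyInt_one, if_neg (by omega)] at h2
  simp only [polyInt_apply] at h1 h2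
  rw [h1]
  linarith

/-- For r = 1/(1+tx/N), write r^N = (1+x) · r^N/(1+x). The factor x costs at most the jump rate out
of `j`, and (1-t/N)^N r^N/(1+x) is dominated by 1/(1+x); then N → ∞. -/
theorem mul_integral_exp_le_resolvent (hr : IsRates lam mu) (hE : NotEntrance lam mu)
    (hw : IsSpectralMeasure lam mu w) {t : ℝ} (ht : 0 ≤ t) (m j : ℕ) :
    Real.exp (-t) *
      ∫ x, (orthoPoly lam mu m * orthoPoly lam mu j).eval x * Real.exp (-(t * x)) ∂w ≤
      (1 + (lam j + mu j)) *
        ∫ x, (orthoPoly lam mu m * orthoPoly lam mu j).eval x * (1 + x)⁻¹ ∂w := by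
  have hmu : 0 ≤ mu j := by
    cases j with
    | zero => exact hr.kill_nonneg
    | succ j => exact (hr.death_pos j).le
  have hc : 0 ≤ 1 + (lam j + mu j) := by linarith [hr.birth_pos j]
  refine le_of_tendsto ((tendsto_one_sub_pow_exp t).mul
    (tendsto_polyInt_exp_of_inv_pow hw ht _)) ?_
  filter_upwards [eventually_div_le_one t] with N hN
  have ha : 0 ≤ t / N := by positivity
  set a := t / (N : ℝ)
  have hR := bdd_resolvent hw
  have hp : PosType lam mu w fun x => (1 + a * x)⁻¹ ^ N * (1 + x)⁻¹ := by
    simpa only [one_mul] using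
      (PosType.inv_one_add_pow hr hE hw ha N).mul_inv_one_add hr hE hw zero_le_one
  have hrN := (bdd_inv_one_add hw ha).pow N
  set P := orthoPoly lam mu m * orthoPoly lam mu j with hP
  set T := polyInt hw.moments hp.bdd with hT
  have h1 : T P + T (X * P) = ∫ x, P.eval x * (1 + a * x)⁻¹ ^ N ∂w := by
    rw [← map_add, ← polyInt_apply hw.moments hrN]
    refine polyInt_congr _ _ _ ?_
    filter_upwards [hw.ae_nonneg] with x hx
    have : 1 + x ≠ 0 := by positivity
    simp only [eval_add, eval_mul, eval_X]
    field_simp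
  -- Apply the generator in the variable `j`: only its diagonal term contributes positively to `T (X
  -- * P)`, the neighbouring terms being nonnegative quantities that are subtracted.
  have h2 : 0 ≤ (lam j + mu j) * T P - T (X * P) := by
    have hT0 : ∀ l, 0 ≤ T (orthoPoly lam mu l * orthoPoly lam mu m) := fun l => hp.nonneg l m
    have h3 := gen_linearMap hr T (orthoPoly lam mu m) j
    rw [hP, mul_comm (orthoPoly lam mu m), mul_left_comm]
    cases j with
    | zero =>
      simp only [gen] at h3
      nlinarith [mul_nonneg (hr.birth_pos 0).le (hT0 1)]
    | succ j =>
      simp only [gen] at h3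
      nlinarith [mul_nonneg (hr.birth_pos (j + 1)).le (hT0 (j + 2)), mul_nonneg hmu (hT0 j)]
  have h4 := (posType_inv_one_add_sub hr hE hw ha hN N).nonneg m j
  simp only [mul_sub, mul_left_comm _ ((1 - a) ^ N)] at h4
  rw [integral_sub (integrable_eval_mul hw.moments hR _)
    ((integrable_eval_mul hw.moments hp.bdd _).const_mul _), integral_const_mul] at h4
  change 0 ≤ _ - (1 - a) ^ N * T P at h4
  rw [← h1]
  have hq : 0 ≤ (1 - a) ^ N := pow_nonneg (by linarith) N
  calc (1 - a) ^ N * (T P + T (X * P)) ≤ (1 - a) ^ N * ((1 + (lam j + mu j)) * T P) :=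
        mul_le_mul_of_nonneg_left (by linarith) hq
    _ = (1 + (lam j + mu j)) * ((1 - a) ^ N * T P) := by ring
    _ ≤ _ := mul_le_mul_of_nonneg_left (by linarith) hc

/-- The Feller property: transition probabilities vanish as the starting point tends to `∞`. -/
theorem tendsto_integral_exp_zero (hr : IsRates lam mu) (hE : NotEntrance lam mu)
    (hw : IsSpectralMeasure lam mu w) {t : ℝ} (ht : 0 ≤ t) (p : ℝ[X]) :
    Tendsto (fun m => ∫ x, (orthoPoly lam mu m * p).eval x * Real.exp (-(t * x)) ∂w)
      atTop (𝓝 0) := by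
  have hb := bdd_exp hw ht
  change Tendsto (fun m => polyInt hw.moments hb (orthoPoly lam mu m * p)) atTop (𝓝 0)
  induction p using orthoPoly_induction hr with
  | hadd p q hp hq => simpa only [mul_add, map_add, add_zero] using hp.add hq
  | hsmul c p hp =>
    simpa only [mul_smul_comm, map_smul, smul_eq_mul, mul_zero] using hp.const_mul c
  | hQ j =>
    have h := ((tendsto_resolvent_zero hr hE hw j).const_mul (1 + (lam j + mu j))).div_const
      (Real.exp (-t))
    rw [mul_zero, zero_div] at h
    refine squeeze_zero (fun m => (PosType.exp hr hE hw ht).nonneg m j) (fun m => ?_) h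
    rw [le_div_iff₀ (Real.exp_pos _), mul_comm]
    exact mul_integral_exp_le_resolvent hr hE hw ht m j

end Semigroup

/-! ### The dual spectral measure and one-dimensional sums -/

section Dual

variable {lam mu : ℕ → ℝ} {w w' : Measure ℝ}

theorem polyInt_one_dual_mul (hr : IsRates lam mu) (hmu0 : mu 0 = 0)
    (hw : IsSpectralMeasure lam mu w) (i m : ℕ) :
    polyInt hw.moments (Bdd.const 1)
      (orthoPoly (dualBirth mu) (dualDeath lam) i * orthoPoly lam mu m) =
        if m ≤ i then 1 else 0 := by
  rw [orthoPoly_dual_eq_sum hr hmu0, Finset.sum_mul, map_sum]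
  simp only [mul_assoc, polyInt_C_mul, hw.polyInt_one, mul_ite, mul_zero]
  rw [Finset.sum_ite_eq']
  simp only [Finset.mem_range, Nat.lt_succ_iff, mul_one_div_cancel (symm_pos hr m).ne']

theorem toReal_ofReal_div_ae (hr : IsRates lam mu) (hw : IsSpectralMeasure lam mu w) :
    ∀ᵐ x ∂w, (ENNReal.ofReal (x / lam 0)).toReal = x / lam 0 := by
  filter_upwards [hw.ae_nonneg] with x hx
  exact ENNReal.toReal_ofReal (div_nonneg hx (hr.birth_pos 0).le)

theorem integral_withDensity_dual (hr : IsRates lam mu) (hw : IsSpectralMeasure lam mu w)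
    (f : ℝ → ℝ) :
    ∫ x, f x ∂(w.withDensity fun x => ENNReal.ofReal (x / lam 0)) =
      ∫ x, x / lam 0 * f x ∂w := by
  rw [integral_withDensity_eq_integral_toReal_smul (by fun_prop)
    (Eventually.of_forall fun x => ENNReal.ofReal_lt_top)]
  refine integral_congr_ae ?_
  filter_upwards [toReal_ofReal_div_ae hr hw] with x hx
  rw [hx, smul_eq_mul]

/-- The factor x turns π̂(j) Q̂_j into λ₀(Q_j - Q_{j+1}). Since ∫ Q̂_i Q_m dw is the indicator of m
≤ i, the difference of two such indicators is δ_{ij}. -/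
theorem isSpectralMeasure_dual (hr : IsRates lam mu) (hmu0 : mu 0 = 0)
    (hw : IsSpectralMeasure lam mu w) :
    IsSpectralMeasure (dualBirth mu) (dualDeath lam)
      (w.withDensity fun x => ENNReal.ofReal (x / lam 0)) where
  support := withDensity_absolutelyContinuous w _ hw.support
  moments m := by
    rw [integrable_withDensity_iff (by fun_prop)
      (Eventually.of_forall fun x => ENNReal.ofReal_lt_top)]
    refine ((hw.moments (m + 1)).div_const (lam 0)).congr ?_
    filter_upwards [toReal_ofReal_div_ae hr hw] with x hx
    rw [hx, pow_succ, mul_div_assoc]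
  orthogonal i j := by
    rw [integral_withDensity_dual hr hw]
    have hl := (hr.birth_pos 0).ne'
    have hpi := (symm_pos hr.dual j).ne'
    set Q' := orthoPoly (dualBirth mu) (dualDeath lam) with hQ'
    set T := polyInt hw.moments (Bdd.const 1) with hT
    have h1 : ∫ x, x / lam 0 * ((Q' i).eval x * (Q' j).eval x) ∂w =
        (lam 0)⁻¹ * T (Q' i * (X * Q' j)) := by
      rw [hT, polyInt_apply, ← integral_const_mul]
      congr 1
      funext x
      simp only [eval_mul, eval_X]
      ring
    have h2 : symm (dualBirth mu) (dualDeath lam) j * T (Q' i * (X * Q' j)) =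
        lam 0 * ((if j ≤ i then 1 else 0) - if j + 1 ≤ i then 1 else 0) := by
      rw [← polyInt_one_dual_mul hr hmu0 hw, ← polyInt_one_dual_mul hr hmu0 hw, ← map_sub,
        ← polyInt_C_mul, ← polyInt_C_mul]
      congr 1
      linear_combination Q' i * orthoPoly_succ_sub hr hmu0 j
    rw [h1]
    rcases lt_trichotomy i j with hij | rfl | hij
    · rw [if_neg (by omega), if_neg (by omega), sub_zero, mul_zero] at h2
      rw [if_neg hij.ne, (mul_eq_zero.1 h2).resolve_left hpi, mul_zero]
    · rw [if_pos le_rfl, if_neg (by omega), sub_zero, mul_one] at h2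
      rw [if_pos rfl]
      field_simp
      linear_combination h2
    · rw [if_pos (by omega), if_pos (by omega), sub_self, mul_zero] at h2
      rw [if_neg hij.ne', (mul_eq_zero.1 h2).resolve_left hpi, mul_zero]

theorem integral_dual (hr : IsRates lam mu) (hmu0 : mu 0 = 0) (hw : IsSpectralMeasure lam mu w)
    (hdet : Determinate (dualBirth mu) (dualDeath lam))
    (hw' : IsSpectralMeasure (dualBirth mu) (dualDeath lam) w') (f : ℝ → ℝ) :
    lam 0 * ∫ x, f x ∂w' = ∫ x, x * f x ∂w := by
  rw [hdet.unique hw' (isSpectralMeasure_dual hr hmu0 hw), integral_withDensity_dual hr hw,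
    ← integral_const_mul]
  have hl := (hr.birth_pos 0).ne'
  congr 1
  funext x
  field_simp

/-- The chain is conservative. -/
theorem tendsto_integral_dual_exp (hr : IsRates lam mu) (hmu0 : mu 0 = 0)
    (hE : NotEntrance (dualBirth mu) (dualDeath lam))
    (hw : IsSpectralMeasure lam mu w) (hdet : Determinate (dualBirth mu) (dualDeath lam))
    (hw' : IsSpectralMeasure (dualBirth mu) (dualDeath lam) w') {t : ℝ} (ht : 0 ≤ t) (p : ℝ[X]) :
    Tendsto (fun y => ∫ x, (orthoPoly (dualBirth mu) (dualDeath lam) y * p).eval x *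
      Real.exp (-(t * x)) ∂w) atTop (𝓝 (p.eval 0)) := by
  set Q' := orthoPoly (dualBirth mu) (dualDeath lam) with hQ'
  have hb := bdd_exp hw ht
  have hl := hr.birth_pos 0
  have hR' := bdd_resolvent hw'
  have hbound : ∀ y, 0 ≤ 1 - polyInt hw.moments hb (Q' y) ∧
      Real.exp (-t) * (1 - polyInt hw.moments hb (Q' y)) ≤
        lam 0 * polyInt hw'.moments hR' (Q' y) := by
    intro y
    have hone : polyInt hw.moments (Bdd.const 1) (Q' y) = 1 := by
      have := polyInt_one_dual_mul hr hmu0 hw y 0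
      simpa [orthoPoly] using this
    have hlim := (tendsto_polyInt_exp_of_inv_pow hw ht (Q' y)).const_sub 1
    have hN : ∀ N : ℕ, 0 ≤ t / N := fun N => by positivity
    have hG : ∀ N : ℕ, PosType (dualBirth mu) (dualDeath lam) w' fun x =>
        ∑ k ∈ Finset.range N, t / N * (1 + t / N * x)⁻¹ ^ (k + 1) := fun N =>
      PosType.sum hw' fun k _ =>
        (PosType.inv_one_add_pow hr.dual hE hw' (hN N) (k + 1)).const_mul (hN N)
    -- Discrete form of 1 - e^{-tx} = x ∫₀^t e^{-sx} ds, with the factor x absorbed into the dual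
    -- measure. For e^{-tx} the left side would be the probability of not lying in {0,…,y} at time t
    -- when starting from 0.
    have heq : ∀ N : ℕ, 1 - ∫ x, (Q' y).eval x * (1 + t / N * x)⁻¹ ^ N ∂w =
        lam 0 * polyInt hw'.moments (hG N).bdd (Q' y) := by
      intro N
      have hrN := (bdd_inv_one_add hw (hN N)).pow N
      refine (congrArg (· - _) hone.symm).trans ?_
      rw [polyInt_apply, polyInt_apply, integral_dual hr hmu0 hw hdet hw', ← integral_sub (integrable_eval_mul hw.moments (Bdd.const 1) _)
          (integrable_eval_mul hw.moments hrN _)]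
      refine integral_congr_ae ?_
      filter_upwards [hw.ae_nonneg] with x hx
      rw [mul_left_comm, mul_sum_inv_one_add_pow (hN N) hx]
      ring
    have hnn : ∀ N : ℕ, 0 ≤ polyInt hw'.moments (hG N).bdd (Q' y) := fun N => by
      have := (hG N).nonneg y 0
      simp only [orthoPoly, mul_one] at this
      exact this
    constructor
    · refine ge_of_tendsto' hlim fun N => ?_
      rw [heq]
      exact mul_nonneg hl.le (hnn N)
    · refine le_of_tendsto ((tendsto_one_sub_pow_exp t).mul hlim) ?_
      filter_upwards [eventually_div_le_one t] with N hN1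
      rw [heq, mul_left_comm]
      refine mul_le_mul_of_nonneg_left ?_ hl.le
      have h4 := (posType_inv_one_add_sub_sum hr.dual hE hw' (hN N) hN1 N).nonneg y 0
      simp only [mul_sub, mul_left_comm _ ((1 - t / (N : ℝ)) ^ N)] at h4
      rw [integral_sub (integrable_eval_mul hw'.moments hR' _)
        ((integrable_eval_mul hw'.moments (hG N).bdd _).const_mul _), integral_const_mul] at h4
      simp only [orthoPoly, mul_one] at h4
      exact sub_nonneg.1 h4
  have hlim1 : Tendsto (fun y => polyInt hw.moments hb (Q' y)) atTop (𝓝 1) := by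
    have h := ((tendsto_resolvent_zero hr.dual hE hw' 0).const_mul (lam 0)).div_const
      (Real.exp (-t))
    simp only [orthoPoly, mul_one, mul_zero, zero_div] at h
    have h0 : Tendsto (fun y => 1 - polyInt hw.moments hb (Q' y)) atTop (𝓝 0) := by
      refine squeeze_zero (fun y => (hbound y).1) (fun y => ?_) h
      rw [le_div_iff₀ (Real.exp_pos _), mul_comm]
      exact (hbound y).2
    simpa using h0.const_sub 1
  -- Split p = p(0) + X · `p.divX`: the constant part tends to p(0), and the factor X moves the rest
  -- to the dual measure, where the Feller property of the dual chain applies.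
  have hlim2 := ((hlim1.const_mul (p.eval 0)).add
    ((tendsto_integral_exp_zero hr.dual hE hw' ht p.divX).const_mul (lam 0)))
  rw [mul_one, mul_zero, add_zero] at hlim2
  refine hlim2.congr fun y => ?_
  change _ = polyInt hw.moments hb (Q' y * p)
  conv_rhs => rw [← divX_mul_X_add p, mul_add, map_add, mul_comm (Q' y) (C _), polyInt_C_mul,
    coeff_zero_eq_eval_zero, add_comm]
  congr 1
  rw [integral_dual hr hmu0 hw hdet hw', polyInt_apply]
  congr 1
  funext x
  simp only [eval_mul, eval_X, ← hQ']
  ring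

theorem sum_symm_mul_integral (hr : IsRates lam mu) (hmu0 : mu 0 = 0)
    (hw : IsSpectralMeasure lam mu w) {t : ℝ} (ht : 0 ≤ t) (p : ℝ[X]) (y : ℕ) :
    ∑ m ∈ Finset.range (y + 1), symm lam mu m *
      ∫ x, (orthoPoly lam mu m * p).eval x * Real.exp (-(t * x)) ∂w =
      ∫ x, (orthoPoly (dualBirth mu) (dualDeath lam) y * p).eval x * Real.exp (-(t * x)) ∂w := by
  rw [← polyInt_apply hw.moments (bdd_exp hw ht), orthoPoly_dual_eq_sum hr hmu0, Finset.sum_mul,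
    map_sum]
  simp only [mul_assoc, polyInt_C_mul]
  rfl

theorem sum_symm_dual_mul_integral (hr : IsRates lam mu) (hmu0 : mu 0 = 0)
    (hw : IsSpectralMeasure lam mu w) (hdet : Determinate (dualBirth mu) (dualDeath lam))
    (hw' : IsSpectralMeasure (dualBirth mu) (dualDeath lam) w') {t : ℝ} (ht : 0 ≤ t) (p : ℝ[X])
    (m : ℕ) :
    ∑ l ∈ Finset.range m, symm (dualBirth mu) (dualDeath lam) l *
      ∫ x, (orthoPoly (dualBirth mu) (dualDeath lam) l * p).eval x * Real.exp (-(t * x)) ∂w' =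
      ∫ x, p.eval x * Real.exp (-(t * x)) ∂w -
        ∫ x, (orthoPoly lam mu m * p).eval x * Real.exp (-(t * x)) ∂w := by
  have hb := bdd_exp hw ht
  simp only [← polyInt_apply hw.moments hb, ← polyInt_apply hw'.moments (bdd_exp hw' ht),
    ← polyInt_C_mul, ← map_sum, ← mul_assoc, ← Finset.sum_mul]
  apply mul_left_cancel₀ (hr.birth_pos 0).ne'
  conv_lhs => rw [polyInt_apply, integral_dual hr hmu0 hw hdet hw']
  rw [← map_sub, ← polyInt_C_mul, polyInt_apply]
  congr 1
  funext x
  have h1 := congrArg (eval x)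
    (sum_symm_dual_mul_orthoPoly_dual hr hmu0 (Nat.zero_le m))
  rw [Nat.Ico_zero_eq_range] at h1
  simp only [eval_mul, eval_X, eval_C, eval_sub, orthoPoly, eval_one] at h1 ⊢
  linear_combination (eval x p * Real.exp (-(t * x))) * h1

/-- For `p` equal to some Q_j the terms are transition probabilities up to a positive constant,
hence nonnegative, and convergence of partial sums suffices; general `p` follows by linearity. -/
theorem hasSum_symm_mul_integral (hr : IsRates lam mu) (hmu0 : mu 0 = 0)
    (hE : NotEntrance lam mu) (hE' : NotEntrance (dualBirth mu) (dualDeath lam))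
    (hw : IsSpectralMeasure lam mu w) (hdet : Determinate (dualBirth mu) (dualDeath lam))
    (hw' : IsSpectralMeasure (dualBirth mu) (dualDeath lam) w') {t : ℝ} (ht : 0 ≤ t) (p : ℝ[X]) :
    HasSum (fun m => symm lam mu m *
      ∫ x, (orthoPoly lam mu m * p).eval x * Real.exp (-(t * x)) ∂w) (p.eval 0) := by
  have hb := bdd_exp hw ht
  change HasSum (fun m => symm lam mu m * polyInt hw.moments hb (orthoPoly lam mu m * p)) _
  induction p using orthoPoly_induction hr with
  | hadd p q hp hq => simpa only [mul_add, map_add, eval_add] using hp.add hq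
  | hsmul c p hp =>
    simpa only [mul_smul_comm, map_smul, smul_eq_mul, eval_smul, mul_left_comm c]
      using hp.mul_left c
  | hQ j =>
    have hnn : ∀ m, 0 ≤ symm lam mu m *
        polyInt hw.moments hb (orthoPoly lam mu m * orthoPoly lam mu j) := fun m =>
      mul_nonneg (symm_pos hr m).le ((PosType.exp hr hE hw ht).nonneg m j)
    rw [hasSum_iff_tendsto_nat_of_nonneg hnn, ← tendsto_add_atTop_iff_nat 1]
    exact (tendsto_integral_dual_exp hr hmu0 hE' hw hdet hw' ht (orthoPoly lam mu j)).congr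
      fun y => (sum_symm_mul_integral hr hmu0 hw ht _ y).symm

/-- The partial sums telescope, and their remainder ∫ Q_m p e^{-tx} dw vanishes by the Feller
property. Unconditional convergence again rests on positivity, now in the dual basis. -/
theorem hasSum_symm_dual_mul_integral (hr : IsRates lam mu) (hmu0 : mu 0 = 0)
    (hE : NotEntrance lam mu) (hE' : NotEntrance (dualBirth mu) (dualDeath lam))
    (hw : IsSpectralMeasure lam mu w) (hdet : Determinate (dualBirth mu) (dualDeath lam))
    (hw' : IsSpectralMeasure (dualBirth mu) (dualDeath lam) w') {t : ℝ} (ht : 0 ≤ t) (p : ℝ[X]) :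
    HasSum (fun m => symm (dualBirth mu) (dualDeath lam) m *
      ∫ x, (orthoPoly (dualBirth mu) (dualDeath lam) m * p).eval x * Real.exp (-(t * x)) ∂w')
      (∫ x, p.eval x * Real.exp (-(t * x)) ∂w) := by
  have hb := bdd_exp hw ht
  have hb' := bdd_exp hw' ht
  change HasSum (fun m => symm (dualBirth mu) (dualDeath lam) m *
    polyInt hw'.moments hb' (orthoPoly (dualBirth mu) (dualDeath lam) m * p))
    (polyInt hw.moments hb p)
  induction p using orthoPoly_induction hr.dual with
  | hadd p q hp hq => simpa only [mul_add, map_add] using hp.add hq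
  | hsmul c p hp =>
    simpa only [mul_smul_comm, map_smul, smul_eq_mul, mul_left_comm c] using hp.mul_left c
  | hQ j =>
    have hnn : ∀ m, 0 ≤ symm (dualBirth mu) (dualDeath lam) m *
        polyInt hw'.moments hb' (orthoPoly (dualBirth mu) (dualDeath lam) m *
          orthoPoly (dualBirth mu) (dualDeath lam) j) := fun m =>
      mul_nonneg (symm_pos hr.dual m).le ((PosType.exp hr.dual hE' hw' ht).nonneg m j)
    rw [hasSum_iff_tendsto_nat_of_nonneg hnn]
    set q := orthoPoly (dualBirth mu) (dualDeath lam) j with hq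
    have h := (tendsto_integral_exp_zero hr hE hw ht q).const_sub (polyInt hw.moments hb q)
    rw [sub_zero] at h
    exact h.congr fun m => (sum_symm_dual_mul_integral hr hmu0 hw hdet hw' ht q m).symm

end Dual

/-! ### Positivity of the harmonic functions -/

section Harmonic

variable {lam mu : ℕ → ℝ}

theorem vdm_ne_zero (n : ℕ) : vdm n ≠ 0 := by
  have h : vdm n = (Matrix.vandermonde
      (fun j : Fin n => (MvPolynomial.X j : MvPolynomial (Fin n) ℝ))).det := by
    rw [← Matrix.det_transpose]
    rfl
  rw [h]
  exact Matrix.det_vandermonde_ne_zero_iff.2 (MvPolynomial.X_injective)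

theorem coeff_modByMonic_X_pow (q : ℝ[X]) {n l : ℕ} (hl : l < n) :
    (q %ₘ (X ^ n)).coeff l = q.coeff l := by
  have h := congrArg (fun p => coeff p l) (modByMonic_add_div q (X ^ n))
  simpa [coeff_X_pow_mul', hl.not_ge] using h

/-- The value at `0` of a multivariate Karlin–McGregor polynomial is the determinant of the
lowest coefficients. -/
theorem eval_zero_multiPoly {n : ℕ} (q : ℕ → ℝ[X]) (ν : Fin n → ℕ) :
    MvPolynomial.eval 0 (multiPoly q ν) =
      (Matrix.of fun i l : Fin n => (q (ν i)).coeff l).det := by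
  classical
  let S := MvPolynomial (Fin n) ℝ
  let g : S[X] := ∏ j : Fin n, (X - C (MvPolynomial.X j))
  have hg : g.Monic := monic_prod_of_monic _ _ fun j _ => monic_X_sub_C _
  have hgd : g.natDegree = n := by
    simp only [g]
    rw [natDegree_prod_of_monic _ _ fun j _ => monic_X_sub_C _]
    simp
  let r : Fin n → S[X] := fun i => ((q (ν i)).map (algebraMap ℝ S)) %ₘ g
  have hr : ∀ i j : Fin n, (r i).eval (MvPolynomial.X j) =
      Polynomial.aeval (MvPolynomial.X j : S) (q (ν i)) := by
    intro i j
    have hroot : g.eval (MvPolynomial.X j) = 0 := by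
      simp only [g]
      rw [eval_prod]
      exact Finset.prod_eq_zero (Finset.mem_univ j) (by simp)
    have h := congrArg (Polynomial.eval (MvPolynomial.X j : S))
      (modByMonic_add_div ((q (ν i)).map (algebraMap ℝ S)) g)
    rw [eval_add, eval_mul, hroot, zero_mul, add_zero, eval_map_algebraMap] at h
    exact h
  have hdeg : ∀ i : Fin n, (r i).natDegree < n := by
    intro i
    refine (natDegree_modByMonic_lt _ hg fun h1 => ?_).trans_eq hgd
    have := i.pos
    rw [h1, natDegree_one] at hgd
    omega
  have hmat : (Matrix.of fun i j : Fin n =>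
      Polynomial.aeval (MvPolynomial.X j : S) (q (ν i))) =
      (Matrix.of fun i l : Fin n => (r i).coeff l) *
        (Matrix.of fun l j : Fin n => (MvPolynomial.X j : S) ^ (l : ℕ)) := by
    ext1 i j
    rw [Matrix.mul_apply, Matrix.of_apply, ← hr i j, eval_eq_sum_range' (hdeg i),
      ← Fin.sum_univ_eq_sum_range (fun l => (r i).coeff l * (MvPolynomial.X j : S) ^ l) n]
    rfl
  have hdet : multiPoly q ν = (Matrix.of fun i l : Fin n => (r i).coeff l).det := by
    apply mul_left_cancel₀ (vdm_ne_zero n)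
    rw [vdm_mul_multiPoly, polyDet, hmat, Matrix.det_mul, mul_comm]
    rfl
  rw [hdet, RingHom.map_det]
  congr 1
  ext i l
  let φ : S →+* ℝ := MvPolynomial.eval 0
  have hX : ∀ j : Fin n, φ (MvPolynomial.X j) = 0 := fun j => MvPolynomial.eval_X j
  -- At x = 0 the modulus ∏(X - x_j) becomes X^n, so the remainders become truncations of the
  -- original polynomials.
  have hgφ : g.map φ = X ^ n := by
    simp only [g, Polynomial.map_prod, Polynomial.map_sub, Polynomial.map_X, Polynomial.map_C, hX]
    simp
  have hφ : (r i).map φ = q (ν i) %ₘ X ^ n := by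
    simp only [r]
    rw [map_modByMonic _ hg, hgφ, Polynomial.map_map]
    congr 1
    convert! Polynomial.map_id
    ext x
    simp [φ]
  change φ ((r i).coeff l) = (q (ν i)).coeff l
  rw [← coeff_map, hφ, coeff_modByMonic_X_pow _ l.2]

/-- A determinant whose rows are sums is positive if all selections of summands give positive
determinants. -/
theorem mul_det_sum_pos {n : ℕ} (A : Fin n → Finset ℕ) (hA : ∀ i, (A i).Nonempty)
    (g : ℕ → Fin n → ℝ) (c : ℝ)
    (h : ∀ r : Fin n → ℕ, (∀ i, r i ∈ A i) → 0 < c * (Matrix.of fun i j => g (r i) j).det) :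
    0 < c * (Matrix.of fun i j => ∑ m ∈ A i, g m j).det := by
  classical
  have h1 := (Matrix.detRowAlternating (n := Fin n) (R := ℝ)).toMultilinearMap.map_sum_finset
    (fun _ m => g m) A
  have h2 : (Matrix.of fun i j => ∑ m ∈ A i, g m j).det =
      ∑ r ∈ Fintype.piFinset A, (Matrix.of fun i j => g (r i) j).det := by
    refine Eq.trans ?_ h1
    change _ = Matrix.det (fun i => ∑ m ∈ A i, g m)
    congr 1
    ext i j
    simp
  rw [h2, Finset.mul_sum]
  refine Finset.sum_pos (fun r hr => h r (Fintype.mem_piFinset.1 hr)) ?_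
  exact Fintype.piFinset_nonempty.2 hA

/-- Subtracting consecutive rows replaces Q̂_{ν_i} by a sum of π(m) Q_m over m in (ν_{i-1}, ν_i].
Every selection from these disjoint consecutive intervals is increasing, so the hypothesis applies
to each summand. -/
theorem mul_det_coeff_dual_pos (hr : IsRates lam mu) (hmu0 : mu 0 = 0) {n : ℕ} {c : ℝ}
    (h : ∀ ν : Fin n → ℕ, StrictMono ν →
      0 < c * (Matrix.of fun i l : Fin n => (orthoPoly lam mu (ν i)).coeff l).det)
    (ν : Fin n → ℕ) (hν : StrictMono ν) :
    0 < c * (Matrix.of fun i l : Fin n =>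
      (orthoPoly (dualBirth mu) (dualDeath lam) (ν i)).coeff l).det := by
  cases n with
  | zero => simpa using h ν hν
  | succ n =>
    let A : Fin (n + 1) → Finset ℕ :=
      Fin.cases (Finset.range (ν 0 + 1)) fun i => Finset.Ioc (ν i.castSucc) (ν i.succ)
    let g : ℕ → Fin (n + 1) → ℝ := fun m l => symm lam mu m * (orthoPoly lam mu m).coeff l
    have hcoeff : ∀ (m : ℕ) (l : Fin (n + 1)),
        (orthoPoly (dualBirth mu) (dualDeath lam) m).coeff l =
          ∑ x ∈ Finset.range (m + 1), g x l := by
      intro m l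
      rw [orthoPoly_dual_eq_sum hr hmu0, finsetSum_coeff]
      simp [g]
    rw [Matrix.det_eq_of_forall_row_eq_smul_add_pred
      (B := Matrix.of fun i j => ∑ m ∈ A i, g m j) (fun _ => 1) (fun j => ?_) fun i j => ?_]
    · refine mul_det_sum_pos A (fun i => ?_) g c fun r hrA => ?_
      · refine Fin.cases ?_ (fun i => ?_) i
        · exact ⟨0, by simp [A]⟩
        · exact ⟨ν i.succ, by simpa [A] using hν i.castSucc_lt_succ⟩
      · have hup : ∀ i, r i ≤ ν i := by
          intro i
          have := hrA i
          revert this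
          refine Fin.cases ?_ (fun i => ?_) i
          · simp only [A, Fin.cases_zero, Finset.mem_range]; omega
          · simp only [A, Fin.cases_succ, Finset.mem_Ioc]; exact fun h => h.2
        have hmono : StrictMono r := by
          refine Fin.strictMono_iff_lt_succ.2 fun i => (hup _).trans_lt ?_
          have := hrA i.succ
          simp only [A, Fin.cases_succ, Finset.mem_Ioc] at this
          exact this.1
        have h1 := Matrix.det_mul_column (fun i => symm lam mu (r i))
          (Matrix.of fun i l : Fin (n + 1) => (orthoPoly lam mu (r i)).coeff l)
        simp only [Matrix.of_apply] at h1
        rw [h1, mul_left_comm]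
        exact mul_pos (Finset.prod_pos fun i _ => symm_pos hr _) (h r hmono)
    · simp only [Matrix.of_apply, hcoeff, A, Fin.cases_zero]
    · simp only [Matrix.of_apply, hcoeff, A, Fin.cases_succ, one_mul]
      have h1 := (hν i.castSucc_lt_succ).le
      rw [Ioc_eq_Ico_succ]
      exact (Finset.sum_range_add_sum_Ico _ (by omega)).symm.trans (add_comm _ _)

/-- The first column consists of ones because Q_m(0) = 1. Consecutive row differences clear it, and
each is -x/λ₀ times a sum of π̂(m) Q̂_m, which shifts coefficients by one and yields one factor
`-lam 0` for each of the `n` remaining rows. -/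
theorem mul_det_coeff_succ_pos (hr : IsRates lam mu) (hmu0 : mu 0 = 0) {n : ℕ} {c : ℝ}
    (h : ∀ ν : Fin n → ℕ, StrictMono ν → 0 < c * (Matrix.of fun i l : Fin n =>
      (orthoPoly (dualBirth mu) (dualDeath lam) (ν i)).coeff l).det)
    (ν : Fin (n + 1) → ℕ) (hν : StrictMono ν) :
    0 < (-lam 0) ^ n * c *
      (Matrix.of fun i l : Fin (n + 1) => (orthoPoly lam mu (ν i)).coeff l).det := by
  have hl := (hr.birth_pos 0).ne'
  let A : Fin n → Finset ℕ := fun i => Finset.Ico (ν i.castSucc) (ν i.succ)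
  let g : ℕ → Fin n → ℝ := fun m l => symm (dualBirth mu) (dualDeath lam) m *
    (orthoPoly (dualBirth mu) (dualDeath lam) m).coeff l
  let B : Matrix (Fin (n + 1)) (Fin (n + 1)) ℝ := Matrix.of fun i l =>
    (orthoPoly lam mu (ν i)).coeff l -
      Fin.cases 0 (fun i' => (orthoPoly lam mu (ν i'.castSucc)).coeff l) i
  have hone : ∀ m, (orthoPoly lam mu m).coeff 0 = 1 := fun m => by
    rw [coeff_zero_eq_eval_zero, orthoPoly_eval_zero hr hmu0]
  have hcoeff : ∀ (i : Fin n) (l : ℕ),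
      -lam 0 * ((orthoPoly lam mu (ν i.succ)).coeff (l + 1) -
        (orthoPoly lam mu (ν i.castSucc)).coeff (l + 1)) =
      ∑ m ∈ A i, symm (dualBirth mu) (dualDeath lam) m *
        (orthoPoly (dualBirth mu) (dualDeath lam) m).coeff l := by
    intro i l
    have h1 := congrArg (fun p => coeff p (l + 1))
      (sum_symm_dual_mul_orthoPoly_dual hr hmu0 (hν i.castSucc_lt_succ).le)
    simp only [coeff_X_mul, finsetSum_coeff, coeff_C_mul, coeff_sub] at h1
    rw [h1]
    ring
  have hdet : (Matrix.of fun i l : Fin (n + 1) => (orthoPoly lam mu (ν i)).coeff l).det =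
      (B.submatrix Fin.succ Fin.succ).det := by
    rw [Matrix.det_eq_of_forall_row_eq_smul_add_pred (B := B) (fun _ => 1) (fun j => ?_)
      fun i j => ?_, Matrix.det_succ_column_zero, Fin.sum_univ_succ, Finset.sum_eq_zero]
    · simp [B, hone]
    · intro i _
      simp [B, hone]
    · simp [B]
    · simp [B]
  have hsum : (-lam 0) ^ n * (B.submatrix Fin.succ Fin.succ).det =
      (Matrix.of fun i j : Fin n => ∑ m ∈ A i, g m j).det := by
    have h1 := Matrix.det_smul (B.submatrix Fin.succ Fin.succ) (-lam 0)
    rw [Fintype.card_fin] at h1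
    rw [← h1]
    congr 1
    ext i l
    simp only [Matrix.smul_apply, smul_eq_mul, Matrix.submatrix_apply, Matrix.of_apply, B,
      Fin.cases_succ, Fin.val_succ, g]
    exact hcoeff i l
  rw [hdet, mul_right_comm, hsum, mul_comm]
  refine mul_det_sum_pos A (fun i => ⟨ν i.castSucc, ?_⟩) g c fun r hrA => ?_
  · exact Finset.mem_Ico.2 ⟨le_rfl, hν i.castSucc_lt_succ⟩
  · have hmono : StrictMono r := by
      intro i j hij
      have h1 := (Finset.mem_Ico.1 (hrA i)).2
      have h2 := (Finset.mem_Ico.1 (hrA j)).1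
      exact (h1.trans_le (hν.monotone (show i.succ ≤ j.castSucc from hij))).trans_le h2
    have h1 := Matrix.det_mul_column (fun i => symm (dualBirth mu) (dualDeath lam) (r i))
      (Matrix.of fun i l : Fin n =>
        (orthoPoly (dualBirth mu) (dualDeath lam) (r i)).coeff l)
    simp only [Matrix.of_apply] at h1
    rw [h1, mul_left_comm]
    exact mul_pos (Finset.prod_pos fun i _ => symm_pos hr.dual _) (h r hmono)

theorem mul_det_coeff_pos (hr : IsRates lam mu) (hmu0 : mu 0 = 0) (n : ℕ) (ν : Fin n → ℕ)
    (hν : StrictMono ν) :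
    0 < (-lam 0) ^ n.choose 2 *
      (Matrix.of fun i l : Fin n => (orthoPoly lam mu (ν i)).coeff l).det := by
  induction n with
  | zero => simp
  | succ n ih =>
    rw [Nat.choose_succ_succ' n 1, Nat.choose_one_right, pow_add]
    exact mul_det_coeff_succ_pos hr hmu0 (mul_det_coeff_dual_pos hr hmu0 ih) ν hν

theorem harmOdd_pos (hr : IsRates lam mu) (hmu0 : mu 0 = 0) {n : ℕ} (ν : Chamber n) :
    0 < harmOdd lam mu ν := by
  rw [harmOdd, eval_zero_multiPoly, ← mul_pow, neg_one_mul]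
  exact mul_det_coeff_pos hr hmu0 n ν.1 ν.2

theorem harmEven_pos (hr : IsRates lam mu) (hmu0 : mu 0 = 0) {n : ℕ} (ν : Chamber n) :
    0 < harmEven lam mu ν := by
  rw [harmEven, eval_zero_multiPoly, ← mul_pow, neg_one_mul]
  exact mul_det_coeff_dual_pos hr hmu0 (mul_det_coeff_pos hr hmu0 n) ν.1 ν.2

end Harmonic

/-! ### Summing determinants over interlacing configurations -/

section Determinants

theorem hasSum_mul_prod {ι κ : Type*} {f : ι → ℝ} {g : κ → ℝ} {s r : ℝ} (hf : HasSum f s)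
    (hg : HasSum g r) : HasSum (fun x : ι × κ => f x.1 * g x.2) (s * r) :=
  hf.mul hg (summable_mul_of_summable_norm hf.summable.norm hg.summable.norm)

theorem hasSum_prod_pi {n : ℕ} {g : Fin n → ℕ → ℝ} {s : Fin n → ℝ}
    (h : ∀ i, HasSum (g i) (s i)) :
    HasSum (fun ν : Fin n → ℕ => ∏ i, g i (ν i)) (∏ i, s i) := by
  induction n with
  | zero => simp
  | succ n ih =>
    have h1 := ih fun i => h i.succ
    have h2 := hasSum_mul_prod (h 0) h1
    rw [← (Fin.consEquiv fun _ : Fin (n + 1) => ℕ).hasSum_iff, Fin.prod_univ_succ]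
    refine h2.congr_fun fun x => ?_
    simp [Fin.prod_univ_succ, Fin.consEquiv]

/-- In the Leibniz expansion each term is a product of functions of separate indices, and absolutely
convergent real series may be multiplied. -/
theorem hasSum_det {n : ℕ} {f : Fin n → ℕ → Fin n → ℝ} {s : Fin n → Fin n → ℝ}
    (h : ∀ i j, HasSum (fun m => f i m j) (s i j)) :
    HasSum (fun ν : Fin n → ℕ => (Matrix.of fun i j => f i (ν i) j).det) (Matrix.of s).det := by
  have hdet : ∀ M : Fin n → Fin n → ℝ, (Matrix.of M).det =
      ∑ σ : Equiv.Perm (Fin n), ((Equiv.Perm.sign σ : ℤ) : ℝ) * ∏ i, M i (σ i) := fun M => by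
    rw [← Matrix.det_transpose, Matrix.det_apply']
    rfl
  simp only [hdet]
  exact hasSum_sum fun σ _ => (hasSum_prod_pi fun i => h i (σ i)).mul_left _

/-- Summation of a determinant over a product set contained in the chamber. -/
theorem hasSum_chamber_det {n : ℕ} {S : Fin n → Set ℕ} {P : Chamber n → Prop} [DecidablePred P]
    (hS : ∀ ν : Fin n → ℕ, (∀ i, ν i ∈ S i) → StrictMono ν)
    (hP : ∀ ν : Chamber n, P ν ↔ ∀ i, ν.1 i ∈ S i) {a : ℕ → Fin n → ℝ} {s : Fin n → Fin n → ℝ}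
    (h : ∀ i j, HasSum ((S i).indicator fun m => a m j) (s i j)) :
    HasSum (fun ν : Chamber n => if P ν then (Matrix.of fun i j => a (ν.1 i) j).det else 0)
      (Matrix.of s).det := by
  have h1 := hasSum_det (f := fun i m j => (S i).indicator (fun m => a m j) m) h
  have hzero : ∀ ν : Fin n → ℕ, (¬ ∀ i, ν i ∈ S i) →
      (Matrix.of fun i j => (S i).indicator (fun m => a m j) (ν i)).det = 0 := by
    intro ν hν
    push Not at hν
    obtain ⟨i, hi⟩ := hν
    exact Matrix.det_eq_zero_of_row_eq_zero i fun j => by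
      rw [Matrix.of_apply, Set.indicator_of_notMem hi]
  rw [← hasSum_subtype_iff_of_support_subset (s := {ν : Fin n → ℕ | StrictMono ν})] at h1
  · refine h1.congr_fun fun ν => ?_
    by_cases hν : P ν
    · have hν' := (hP ν).1 hν
      simp only [if_pos hν, Function.comp_apply, Set.indicator_of_mem (hν' _)]
    · rw [if_neg hν]
      exact (hzero ν.1 fun h => hν ((hP ν).2 h)).symm
  · intro ν hν
    by_contra hcon
    exact hν (hzero ν fun h => hcon (hS ν h))

theorem hasSum_indicator_finset (F : Finset ℕ) (f : ℕ → ℝ) :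
    HasSum ((F : Set ℕ).indicator f) (∑ m ∈ F, f m) := by
  have h : HasSum ((F : Set ℕ).indicator f) (∑ m ∈ F, (F : Set ℕ).indicator f m) :=
    hasSum_sum_of_ne_finset_zero fun m hm => Set.indicator_of_notMem (by simpa using hm) f
  rwa [Finset.sum_congr rfl fun m hm => Set.indicator_of_mem (by simpa using hm) f] at h

theorem hasSum_indicator_Ici {f : ℕ → ℝ} {s : ℝ} (h : HasSum f s) (m : ℕ) :
    HasSum ((Set.Ici m).indicator f) (s - ∑ l ∈ Finset.range m, f l) := by
  refine (h.sub (hasSum_indicator_finset (Finset.range m) f)).congr_fun fun l => ?_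
  by_cases hl : m ≤ l
  · simp [Set.indicator, hl, not_lt.2 hl]
  · simp [Set.indicator, hl, not_le.1 hl]

theorem hasSum_indicator_diff {f : ℕ → ℝ} {U L : Set ℕ} {s r : ℝ} (hLU : L ⊆ U)
    (hU : HasSum (U.indicator f) s) (hL : HasSum (L.indicator f) r) :
    HasSum ((U \ L).indicator f) (s - r) := by
  rw [Set.indicator_sdiff hLU]
  exact hU.sub hL

/-- The index ν_i ranges over the set difference `U i \ L i` of two initial segments, the last `U`
being all of ℕ. Since `L` is `U` shifted by one row, the differences of row sums are undone by row
operations. -/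
theorem hasSum_interlaceSucc {n : ℕ} {a : ℕ → Fin (n + 1) → ℝ} {v : Fin (n + 1) → ℝ}
    (ha : ∀ j, HasSum (fun m => a m j) (v j)) (k : Chamber n) [DecidablePred (InterlaceSucc · k)] :
    HasSum (fun ν : Chamber (n + 1) =>
        if InterlaceSucc ν k then (Matrix.of fun i j => a (ν.1 i) j).det else 0)
      (Matrix.of fun i j : Fin (n + 1) =>
        Fin.lastCases (v j) (fun l => ∑ m ∈ Finset.range (k.1 l + 1), a m j) i).det := by
  let U : Fin (n + 1) → Set ℕ :=
    fun i => Fin.lastCases Set.univ (fun l => (Finset.range (k.1 l + 1) : Set ℕ)) i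
  let L : Fin (n + 1) → Set ℕ :=
    fun i => Fin.cases ∅ (fun l => (Finset.range (k.1 l + 1) : Set ℕ)) i
  let A : Fin (n + 1) → Fin (n + 1) → ℝ := fun i j =>
    Fin.lastCases (v j) (fun l => ∑ m ∈ Finset.range (k.1 l + 1), a m j) i
  let B : Fin (n + 1) → Fin (n + 1) → ℝ := fun i j =>
    Fin.cases 0 (fun l => ∑ m ∈ Finset.range (k.1 l + 1), a m j) i
  have hdet : (Matrix.of A).det = (Matrix.of fun i j => A i j - B i j).det := by
    refine Matrix.det_eq_of_forall_row_eq_smul_add_pred (fun _ => 1) (fun j => ?_) fun i j => ?_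
    · simp [B]
    · simp [A, B]
  change HasSum _ (Matrix.of A).det
  rw [hdet]
  have hmemU : ∀ (ν : Fin (n + 1) → ℕ), (∀ i, ν i ∈ U i) ↔ ∀ l : Fin n, ν l.castSucc ≤ k.1 l := by
    intro ν
    rw [Fin.forall_fin_succ']
    simp [U]
  have hmemL : ∀ (ν : Fin (n + 1) → ℕ), (∀ i, ν i ∉ L i) ↔ ∀ l : Fin n, k.1 l < ν l.succ := by
    intro ν
    rw [Fin.forall_fin_succ]
    simp [L]
  have hmem : ∀ (ν : Fin (n + 1) → ℕ), (∀ i, ν i ∈ U i \ L i) ↔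
      ∀ l : Fin n, ν l.castSucc ≤ k.1 l ∧ k.1 l < ν l.succ := by
    intro ν
    simp only [Set.mem_sdiff, forall_and, hmemU, hmemL]
  refine hasSum_chamber_det (S := fun i => U i \ L i) (P := (InterlaceSucc · k)) (a := a)
    (s := fun i j => A i j - B i j) (fun ν hν => ?_) (fun ν => (hmem ν.1).symm)
    fun i j => ?_
  · rw [hmem] at hν
    exact Fin.strictMono_iff_lt_succ.2 fun l => (hν l).1.trans_lt (hν l).2
  · refine hasSum_indicator_diff ?_ ?_ ?_
    · refine Fin.cases ?_ (fun l => ?_) i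
      · simp [L]
      · intro m hm
        have hm' : m ≤ k.1 l := by simpa [L] using hm
        have : ∀ i : Fin (n + 1), l.succ ≤ i → m ∈ U i := by
          intro i
          refine Fin.lastCases ?_ (fun l' => ?_) i
          · simp [U]
          · intro hl
            have : k.1 l < k.1 l' := k.2 (by
              rw [Fin.le_def] at hl; rw [Fin.lt_def]; simp at hl; omega)
            simp only [U, Fin.lastCases_castSucc, Finset.coe_range, Set.mem_Iio]
            omega
        exact this _ le_rfl
    · refine Fin.lastCases ?_ (fun l => ?_) i
      · simpa [U, A] using ha j
      · simpa only [U, A, Fin.lastCases_castSucc] using hasSum_indicator_finset _ _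
    · refine Fin.cases ?_ (fun l => ?_) i
      · simp [L, B]
      · simpa only [L, B, Fin.cases_succ] using hasSum_indicator_finset _ _

/-- Here ν_i ranges over a difference of final segments, from k_i up to but excluding k_{i+1}; only
the last index is unbounded. -/
theorem hasSum_interlaceSame {n : ℕ} {a b : ℕ → Fin (n + 1) → ℝ}
    (ha : ∀ m j, HasSum ((Set.Ici m).indicator fun l => a l j) (b m j)) (k : Chamber (n + 1))
    [DecidablePred (InterlaceSame · k)] :
    HasSum (fun ν : Chamber (n + 1) =>
        if InterlaceSame ν k then (Matrix.of fun i j => a (ν.1 i) j).det else 0)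
      (Matrix.of fun i j : Fin (n + 1) => b (k.1 i) j).det := by
  let L : Fin (n + 1) → Set ℕ := fun i => Fin.lastCases ∅ (fun l => Set.Ici (k.1 l.succ)) i
  let B : Fin (n + 1) → Fin (n + 1) → ℝ := fun i j =>
    Fin.lastCases 0 (fun l => b (k.1 l.succ) j) i
  have hdet : (Matrix.of fun i j : Fin (n + 1) => b (k.1 i) j).det =
      (Matrix.of fun i j : Fin (n + 1) => b (k.1 i) j - B i j).det := by
    -- Each row is corrected by its successor, whereas the row operation lemma uses the predecessor;
    -- reversing rows and columns together leaves the determinant unchanged.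
    rw [← Matrix.det_submatrix_equiv_self Fin.revPerm,
      ← Matrix.det_submatrix_equiv_self Fin.revPerm (Matrix.of fun i j => b (k.1 i) j - B i j)]
    refine Matrix.det_eq_of_forall_row_eq_smul_add_pred (fun _ => 1) (fun j => ?_) fun i j => ?_
    · simp [B]
    · simp [B, Fin.rev_succ, Fin.rev_castSucc]
  rw [hdet]
  have hmemL : ∀ (ν : Fin (n + 1) → ℕ), (∀ i, ν i ∉ L i) ↔
      ∀ l : Fin n, ν l.castSucc < k.1 l.succ := by
    intro ν
    rw [Fin.forall_fin_succ']
    simp [L]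
  have hmem : ∀ (ν : Fin (n + 1) → ℕ), (∀ i, ν i ∈ Set.Ici (k.1 i) \ L i) ↔
      (∀ i, k.1 i ≤ ν i) ∧ ∀ l : Fin n, ν l.castSucc < k.1 l.succ := by
    intro ν
    simp only [Set.mem_sdiff, forall_and, hmemL, Set.mem_Ici]
  refine hasSum_chamber_det (S := fun i => Set.Ici (k.1 i) \ L i) (fun ν hν => ?_) (fun ν => ?_)
    fun i j => ?_
  · rw [hmem] at hν
    exact Fin.strictMono_iff_lt_succ.2 fun l => (hν.2 l).trans_le (hν.1 _)
  · rw [hmem]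
    refine and_congr Iff.rfl ⟨fun h l => h _ _ (by simp), fun h i j hij => ?_⟩
    have hi : (i : ℕ) < n := by omega
    have h1 := h ⟨i, hi⟩
    rwa [show j = Fin.succ ⟨i, hi⟩ from Fin.ext (by simp [← hij])]
  · refine hasSum_indicator_diff ?_ (ha _ j) ?_
    · refine Fin.lastCases ?_ (fun l => ?_) i
      · simp [L]
      · simp only [L, Fin.lastCases_castSucc, Set.Ici_subset_Ici]
        exact (k.2 l.castSucc_lt_succ).le
    · refine Fin.lastCases ?_ (fun l => ?_) i
      · simp [L, B]
      · simpa only [L, B, Fin.lastCases_castSucc] using ha _ j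

end Determinants

/-! ### The two coherence relations -/

section Coherence

theorem integral_entry {lam mu : ℕ → ℝ} (w : Measure ℝ) {p : ℝ[X]} {t : ℝ} {ψ : ℝ → ℝ}
    (hψ : ∀ x, ψ x = p.eval x * Real.exp (-(t * x))) (m e : ℕ) :
    ∫ x, symm lam mu m * (orthoPoly lam mu m).eval x * ((-x) ^ e * ψ x) ∂w =
      symm lam mu m * ∫ x, (orthoPoly lam mu m * ((-X) ^ e * p)).eval x *
        Real.exp (-(t * x)) ∂w := by
  rw [← integral_const_mul]
  congr 1
  funext x
  simp only [hψ, eval_mul, eval_pow, eval_neg, eval_X]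
  ring

theorem mul_mul_mul_div_cancel {h : ℝ} (hh : h ≠ 0) (c d e : ℝ) :
    c * d * h * (e / h) = c * e * d := by
  field_simp

theorem det_succ_of_last_row {n : ℕ} (A : Matrix (Fin (n + 1)) (Fin (n + 1)) ℝ)
    (h : ∀ j, A (Fin.last n) j = if j = Fin.last n then 1 else 0) :
    A.det = (A.submatrix Fin.castSucc Fin.castSucc).det := by
  rw [Matrix.det_succ_row A (Fin.last n), Finset.sum_eq_single (Fin.last n)]
  · rw [h, if_pos rfl, Fin.succAbove_last, ← two_mul, pow_mul]
    simp
  · intro j _ hj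
    rw [h, if_neg hj]
    simp
  · simp

theorem sign_div_mul_pow {l : ℝ} (hl : l ≠ 0) (n : ℕ) :
    (-1) ^ (n + 1).choose 2 / l ^ (n + 1).choose 2 * (-l) ^ n =
      (-1) ^ n.choose 2 / l ^ n.choose 2 := by
  rw [Nat.choose_succ_succ' n 1, Nat.choose_one_right, pow_add, pow_add, neg_pow l n]
  have h1 : ((-1 : ℝ) ^ n) * (-1) ^ n = 1 := by rw [← mul_pow]; simp
  have h2 := pow_ne_zero n hl
  field_simp
  linear_combination h1

variable {lam mu : ℕ → ℝ} {w w' : Measure ℝ} {p : ℝ[X]} {t : ℝ} {ψ : ℝ → ℝ}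

theorem hasSum_cohOdd_mul_linkSucc (hr : IsRates lam mu) (hmu0 : mu 0 = 0)
    (hE : NotEntrance lam mu) (hE' : NotEntrance (dualBirth mu) (dualDeath lam))
    (hw : IsSpectralMeasure lam mu w) (hdet : Determinate (dualBirth mu) (dualDeath lam))
    (hw' : IsSpectralMeasure (dualBirth mu) (dualDeath lam) w') (ht : 0 ≤ t)
    (hψ : ∀ x, ψ x = p.eval x * Real.exp (-(t * x))) (hψ0 : ψ 0 = 1) {n : ℕ} (k : Chamber n) :
    HasSum (fun ν : Chamber (n + 1) => cohOdd lam mu w ψ ν * linkSucc lam mu ν k)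
      (cohEven lam mu w' ψ k) := by
  classical
  have hl := (hr.birth_pos 0).ne'
  have hp0 : p.eval 0 = 1 := by simpa [hψ] using hψ0
  set a : ℕ → Fin (n + 1) → ℝ := fun m j =>
    ∫ x, symm lam mu m * (orthoPoly lam mu m).eval x * ((-x) ^ (n + 1 - 1 - (j : ℕ)) * ψ x) ∂w
    with ha
  -- The total sum is the value at 0 of `(-X)^(n-j) * p` with `j` counted from 0; only the last
  -- column has exponent zero, and there ψ(0) = 1 enters.
  have hsum : ∀ j, HasSum (fun m => a m j) (if j = Fin.last n then 1 else 0) := by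
    intro j
    have h := hasSum_symm_mul_integral hr hmu0 hE hE' hw hdet hw' ht
      ((-X) ^ (n + 1 - 1 - (j : ℕ)) * p)
    simp only [← integral_entry w hψ] at h
    convert h using 1
    rw [eval_mul, hp0, mul_one]
    split_ifs with hj
    · simp [hj]
    · have : n + 1 - 1 - (j : ℕ) ≠ 0 := by
        have h1 := Fin.val_lt_last hj
        omega
      rw [eval_pow, eval_neg, eval_X, neg_zero, zero_pow this]
  have h := hasSum_interlaceSucc hsum k
  rw [det_succ_of_last_row _ fun j => by simp] at h
  set E : Matrix (Fin n) (Fin n) ℝ := Matrix.of fun i j =>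
    ∫ x, (orthoPoly (dualBirth mu) (dualDeath lam) (k.1 i)).eval x *
      ((-x) ^ (n - 1 - (j : ℕ)) * ψ x) ∂w' with hEdef
  -- Initial sums produce the dual polynomial under `w`. In the columns before the last the exponent
  -- of `-x` is positive, so one factor -x can be traded for `-lam 0` and the measure `w'`.
  have hdetE : (Matrix.submatrix (Matrix.of fun i j : Fin (n + 1) =>
      Fin.lastCases (if j = Fin.last n then 1 else 0)
        (fun l => ∑ m ∈ Finset.range (k.1 l + 1), a m j) i) Fin.castSucc Fin.castSucc).det =
      (-lam 0) ^ n * E.det := by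
    have h1 := Matrix.det_smul E (-lam 0)
    rw [Fintype.card_fin] at h1
    rw [← h1]
    congr 1
    ext i j
    simp only [Matrix.submatrix_apply, Matrix.of_apply, Fin.lastCases_castSucc,
      Matrix.smul_apply, smul_eq_mul, hEdef, ha, integral_entry w hψ]
    rw [sum_symm_mul_integral hr hmu0 hw ht, neg_mul, integral_dual hr hmu0 hw hdet hw',
      ← integral_neg]
    congr 1
    funext x
    have hj : n + 1 - 1 - (j.castSucc : ℕ) = n - 1 - (j : ℕ) + 1 := by
      simp only [Fin.val_castSucc]
      omega
    simp only [eval_mul, eval_pow, eval_neg, eval_X, hψ, hj, pow_succ]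
    ring
  rw [hdetE] at h
  have hcoh : cohEven lam mu w' ψ k = ((-1) ^ (n + 1).choose 2 / lam 0 ^ (n + 1).choose 2 *
      ((∏ i, symm (dualBirth mu) (dualDeath lam) (k.1 i)) * harmEven lam mu k)) *
      ((-lam 0) ^ n * E.det) := by
    have h1 := Matrix.det_mul_column
      (fun i => symm (dualBirth mu) (dualDeath lam) (k.1 i)) E
    rw [cohEven, ← sign_div_mul_pow hl n]
    simp only [mul_assoc, integral_const_mul]
    simp only [hEdef, Matrix.of_apply] at h1 ⊢
    rw [h1]
    ring
  rw [hcoh]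
  refine (h.mul_left _).congr_fun fun ν => ?_
  rw [linkSucc, cohOdd]
  split_ifs with hint
  · exact mul_mul_mul_div_cancel (harmOdd_pos hr hmu0 ν).ne' _ _ _
  · simp

theorem hasSum_cohEven_mul_linkSame (hr : IsRates lam mu) (hmu0 : mu 0 = 0)
    (hE : NotEntrance lam mu) (hE' : NotEntrance (dualBirth mu) (dualDeath lam))
    (hw : IsSpectralMeasure lam mu w) (hdet : Determinate (dualBirth mu) (dualDeath lam))
    (hw' : IsSpectralMeasure (dualBirth mu) (dualDeath lam) w') (ht : 0 ≤ t)
    (hψ : ∀ x, ψ x = p.eval x * Real.exp (-(t * x))) {n : ℕ} (k : Chamber (n + 1)) :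
    HasSum (fun ν : Chamber (n + 1) => cohEven lam mu w' ψ ν * linkSame lam mu ν k)
      (cohOdd lam mu w ψ k) := by
  classical
  set a : ℕ → Fin (n + 1) → ℝ := fun m j =>
    ∫ x, symm (dualBirth mu) (dualDeath lam) m *
      (orthoPoly (dualBirth mu) (dualDeath lam) m).eval x *
        ((-x) ^ (n + 1 - 1 - (j : ℕ)) * ψ x) ∂w' with ha
  set b : ℕ → Fin (n + 1) → ℝ := fun m j =>
    ∫ x, (orthoPoly lam mu m).eval x * ((-x) ^ (n + 1 - 1 - (j : ℕ)) * ψ x) ∂w with hb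
  -- Subtracting the explicit partial sum from the total leaves exactly the integral of Q_m against
  -- `w`.
  have hsum : ∀ m j, HasSum ((Set.Ici m).indicator fun l => a l j) (b m j) := by
    intro m j
    have h := hasSum_indicator_Ici (hasSum_symm_dual_mul_integral hr hmu0 hE hE' hw hdet hw' ht
      ((-X) ^ (n + 1 - 1 - (j : ℕ)) * p)) m
    rw [sum_symm_dual_mul_integral hr hmu0 hw hdet hw' ht, sub_sub_cancel] at h
    simp only [← integral_entry w' hψ] at h
    convert h using 1
    simp only [hb]
    congr 1
    funext x
    simp only [eval_mul, eval_pow, eval_neg, eval_X, hψ]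
    ring
  have h := hasSum_interlaceSame hsum k
  have hcoh : cohOdd lam mu w ψ k = ((-1) ^ (n + 1).choose 2 / lam 0 ^ (n + 1).choose 2 *
      ((∏ i, symm lam mu (k.1 i)) * harmOdd lam mu k)) *
      (Matrix.of fun i j : Fin (n + 1) => b (k.1 i) j).det := by
    have h1 := Matrix.det_mul_column (fun i => symm lam mu (k.1 i))
      (Matrix.of fun i j : Fin (n + 1) => b (k.1 i) j)
    rw [cohOdd]
    simp only [mul_assoc, integral_const_mul]
    simp only [hb, Matrix.of_apply] at h1 ⊢
    rw [h1]
    ring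
  rw [hcoh]
  refine (h.mul_left _).congr_fun fun ν => ?_
  rw [linkSame, cohEven]
  split_ifs with hint
  · exact mul_mul_mul_div_cancel (harmEven_pos hr hmu0 ν).ne' _ _ _
  · simp

end Coherence

end BirthDeath

end

theorem mainTheorem10 (lam mu : ℕ → ℝ)
    (hlam : ∀ x, 0 < lam x) (hmu0 : mu 0 = 0) (hmu : ∀ x, 1 ≤ x → 0 < mu x)
    (hnat : BirthDeath.NaturalAtInfinity lam mu)
    (hdet : BirthDeath.Determinate lam mu)
    (hdet' : BirthDeath.Determinate (BirthDeath.dualBirth mu) (BirthDeath.dualDeath lam))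
    (w w' : MeasureTheory.Measure ℝ)
    (hw : BirthDeath.IsSpectralMeasure lam mu w)
    (hw' : BirthDeath.IsSpectralMeasure (BirthDeath.dualBirth mu) (BirthDeath.dualDeath lam) w')
    (p : Polynomial ℝ) (t : ℝ) (ht : 0 ≤ t)
    (ψ : ℝ → ℝ) (hψ : ∀ x, ψ x = p.eval x * Real.exp (-(t * x)))
    (n : ℕ) (hn : 1 ≤ n) (k : BirthDeath.Chamber n) :
    (ψ 0 = 1 →
      HasSum (fun ν : BirthDeath.Chamber (n + 1) =>
          BirthDeath.cohOdd lam mu w ψ ν * BirthDeath.linkSucc lam mu ν k)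
        (BirthDeath.cohEven lam mu w' ψ k)) ∧
    HasSum (fun ν : BirthDeath.Chamber n =>
        BirthDeath.cohEven lam mu w' ψ ν * BirthDeath.linkSame lam mu ν k)
      (BirthDeath.cohOdd lam mu w ψ k) := by
  have hr : BirthDeath.IsRates lam mu := ⟨hlam, hmu0.ge, fun x => hmu (x + 1) (by omega)⟩
  have hE := hnat.notEntrance hr
  have hE' := hnat.notEntrance_dual hr
  refine ⟨fun hψ0 => BirthDeath.hasSum_cohOdd_mul_linkSucc hr hmu0 hE hE' hw hdet' hw' ht hψ hψ0 k,
    ?_⟩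
  obtain ⟨m, rfl⟩ : ∃ m, n = m + 1 := ⟨n - 1, by omega⟩
  exact BirthDeath.hasSum_cohEven_mul_linkSame hr hmu0 hE hE' hw hdet' hw' ht hψ k
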